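/- **Setting.** A *time-like graph* (TLG) here is a finite multigraph (parallel edges allowed) whose vertices $v$ carry times $t_v\in[0,1]$ (not necessarily distinct), with one first vertex at time $0$, one last vertex at time $1$, all other vertices at times in $(0,1)$, every edge directed from a vertex to a vertex of strictly larger time, and every vertex other than the first and the last having at least one incoming and one outgoing edge. A *point* of $\mathcal G$ is a pair $(E,\tau)$ of an edge $E$ from $u$ to $v$ and a time $\tau\in[t_u,t_v]$, where endpoints of edges that are the same vertex are identified. A *time-path* is a sequence of consecutive edges followed forward in time; a *full time-path* $\sigma$ goes from the first to the last vertex, and $\sigma(\tau)$ denotes its point at time $\tau\in[0,1]$. For points write $s\preceq t$ if the time of $s$ is at most the time of $t$ and some full time-path passes through both; $P(t)=\{s: s\preceq t\}$ and $F(t)=\{s: s\succeq t\}$ are the past and the future of $t$. A *TLG\*-tower* is a finite sequence $\mathcal G_0,\dots,\mathcal G_n$ of TLG's, where $\mathcal G_0$ has two vertices (at times $0$ and $1$) and one edge, and $\mathcal G_{l+1}$ is obtained from $\mathcal G_l$ either by (1) adding a new vertex in the interior of an edge, which splits this edge into two, or by (2) adding a new edge from $j$ to $k$, where $t_j<t_k$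 and $j,k$ are connected by a time-path in $\mathcal G_l$. A *TLG\** is the last graph $\mathcal G=\mathcal G_n$ of such a tower. Points and full time-paths of $\mathcal G_l$ are regarded as points and full time-paths of $\mathcal G_{l+1}$, and hence of $\mathcal G$. A *Markov family* on $\mathcal G$ is a family $\mathcal M=\{\mu_\sigma\}$, indexed by the full time-paths $\sigma$ of $\mathcal G$, of distributions of real-valued right-continuous processes with left limits (for example continuous processes) on $[0,1]$, such that each $\mu_\sigma$ is the distribution of a Markov process (at each time, past and future are conditionally independent given the present) and the family is *consistent*: for all $\sigma_1,\sigma_2$, the measures $\mu_{\sigma_1}$ and $\mu_{\sigma_2}$ have the same image under restriction to $T=\{\tau\in[0,1]:\sigma_1(\tau)=\sigma_2(\tau)\}$. It induces a family on each $\mathcal G_l$. A *natural $\mathcal M$-process* on $\mathcal G$ is a process $X=(X(t))_{t\in\mathcal G}$ of real random variables indexed by the points of $\mathcal G$, constructed along a TLG\*-tower ending in $\mathcal G$ as follows; let $X^l$ be its restriction to $\mathcal G_l$. On $\mathcal G_0$, $X^0$ has the distribution given by $\mathcal M$ along the only edge. If $\mathcal G_{l+1}$ arises by adding a vertex, $X^{l+1}$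 has the same values as $X^l$ at the same points. If $\mathcal G_{l+1}$ arises by adding an edge $E^*$ from $j$ to $k$, pick a full time-path $\sigma$ of $\mathcal G_{l+1}$ containing $E^*$, and let $\mu_*(\cdot\mid x,y)$ be a regular version of the conditional distribution of a $\mu_\sigma$-distributed process on $[t_j,t_k]$ given its values $x$ at $t_j$ and $y$ at $t_k$; then $X^{l+1}=X^l$ on $\mathcal G_l$, and the conditional distribution of $(X^{l+1}(t))_{t\in E^*}$ given $X^l$ is $\mu_*(\cdot\mid X^l(j),X^l(k))$. **Theorem.** Let $\mathcal G$ be a TLG\* and $\mathcal M$ a Markov family on $\mathcal G$, and let $X$ be a natural $\mathcal M$-process on $\mathcal G$ (constructed along any TLG\*-tower and with any of the choices above). Then $X$ is time-Markovian: for every point $t$ of $\mathcal G$, the processes $(X(s))_{s\in P(t)}$ and $(X(s))_{s\in F(t)}$ are conditionally independent given $X(t)$. -/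

import Mathlib

open MeasureTheory ProbabilityTheory Set Filter Topology

noncomputable section

/-- A (finite, unit) time-like graph: a finite multigraph whose vertices carry times, with a first
vertex at time `0`, a last vertex at time `1`, all other vertices at times strictly between,
edges directed forward in time, and every intermediate vertex having an incoming and an
outgoing edge. Distinct vertices may have equal times; parallel edges are allowed. -/
structure TLG where
  V : Type
  E : Type
  finite_V : Finite V
  finite_E : Finite E
  time : V → ℝ
  first : V
  last : V
  src : E → V
  tgt : E → V
  time_first : time first = 0
  time_last : time last = 1
  time_pos : ∀ v, v ≠ first → 0 < time v
  time_lt_one : ∀ v, v ≠ last → time v < 1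
  time_lt : ∀ e, time (src e) < time (tgt e)
  exists_in : ∀ v, v ≠ first → v ≠ last → ∃ e, tgt e = v
  exists_out : ∀ v, v ≠ first → v ≠ last → ∃ e, src e = v

namespace TLG

theorem time_mem (G : TLG) (v : G.V) : G.time v ∈ Icc (0 : ℝ) 1 := by
  constructor
  · by_cases h : v = G.first
    · rw [h, G.time_first]
    · exact (G.time_pos v h).le
  · by_cases h : v = G.last
    · rw [h, G.time_last]
    · exact (G.time_lt_one v h).le

/-- The time of a vertex as an element of the time interval `[0, 1]`. -/
def unitTime (G : TLG) (v : G.V) : Icc (0 : ℝ) 1 := ⟨G.time v, G.time_mem v⟩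

/-! ### Points, time-paths, order -/

/-- Points of the graph: pairs (edge, time on that edge), where the endpoints of the edges
are identified with the vertices. So a point is a vertex, or an interior point of an edge. -/
inductive Point (G : TLG) : Type
  | vertex (v : G.V) : Point G
  | inner (e : G.E) (t : ℝ) (h : G.time (G.src e) < t ∧ t < G.time (G.tgt e)) : Point G

/-- The time of a point. -/
def Point.time {G : TLG} : G.Point → ℝ
  | .vertex v => G.time v
  | .inner _ t _ => t

open Classical in
/-- The point of the edge `e` with time `t`, for `t` in `[time (src e), time (tgt e)]`
(other values of `t` are moved to the nearest endpoint). -/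
def edgePoint (G : TLG) (e : G.E) (t : ℝ) : G.Point :=
  if h : G.time (G.src e) < t ∧ t < G.time (G.tgt e) then .inner e t h
  else if t ≤ G.time (G.src e) then .vertex (G.src e)
  else .vertex (G.tgt e)

/-- The list `l` of consecutive edges is a time-path from `u` to `v`. -/
def IsTimePath (G : TLG) : List G.E → G.V → G.V → Prop
  | [], u, v => u = v
  | e :: l, u, v => G.src e = u ∧ G.IsTimePath l (G.tgt e) v

/-- Full time-paths: time-paths from the first to the last vertex. -/
structure FullPath (G : TLG) where
  edges : List G.E
  isTimePath : G.IsTimePath edges G.first G.last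

open Classical in
/-- The point at time `t` on the time-path `l` that starts at the vertex `u`. -/
def pathPoint (G : TLG) : List G.E → G.V → ℝ → G.Point
  | [], u, _ => .vertex u
  | e :: l, _, t => if t < G.time (G.tgt e) then G.edgePoint e t else G.pathPoint l (G.tgt e) t

/-- The point at time `t` on a full time-path. -/
def FullPath.at {G : TLG} (σ : G.FullPath) (t : Icc (0 : ℝ) 1) : G.Point :=
  G.pathPoint σ.edges G.first t

/-- `p ≼ q`: the time of `p` is at most that of `q`, and some full time-path passes through
both. -/
def Point.Le {G : TLG} (p q : G.Point) : Prop :=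
  p.time ≤ q.time ∧ ∃ σ : G.FullPath, (∃ s, σ.at s = p) ∧ (∃ t, σ.at t = q)

/-- The past of a point. -/
def past {G : TLG} (p : G.Point) : Set G.Point := {q | q.Le p}

/-- The future of a point. -/
def future {G : TLG} (p : G.Point) : Set G.Point := {q | p.Le q}

/-! ### The steps of the construction of TLG*'s -/

/-- The minimal graph: two vertices, at times `0` and `1`, and one edge. -/
abbrev minimal : TLG where
  V := Bool
  E := Unit
  finite_V := inferInstance
  finite_E := inferInstance
  time := fun b => if b then 1 else 0
  first := false
  last := true
  src := fun _ => false
  tgt := fun _ => true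
  time_first := by simp
  time_last := by simp
  time_pos := by simp
  time_lt_one := by simp
  time_lt := by simp
  exists_in := by simp
  exists_out := by simp

open Classical in
/-- Adding a vertex at time `τ` on the edge `e`. The new vertex is `none`; the edge `e` is
replaced by its first part `some e` and its second part `none`. -/
abbrev addVertex (G : TLG) (e : G.E) (τ : ℝ)
    (h : G.time (G.src e) < τ ∧ τ < G.time (G.tgt e)) : TLG where
  V := Option G.V
  E := Option G.E
  finite_V := by have := G.finite_V; infer_instance
  finite_E := by have := G.finite_E; infer_instance
  time := fun o => o.elim τ G.time
  first := some G.first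
  last := some G.last
  src := fun o => o.elim none (fun e' => some (G.src e'))
  tgt := fun o => o.elim (some (G.tgt e)) (fun e' => if e' = e then none else some (G.tgt e'))
  time_first := G.time_first
  time_last := G.time_last
  time_pos := by
    rintro (_ | v) hv
    · exact lt_of_le_of_lt (G.time_mem _).1 h.1
    · exact G.time_pos v (fun hh => hv (by rw [hh]))
  time_lt_one := by
    rintro (_ | v) hv
    · exact lt_of_lt_of_le h.2 (G.time_mem _).2
    · exact G.time_lt_one v (fun hh => hv (by rw [hh]))
  time_lt := by
    rintro (_ | e')
    · exact h.2
    · by_cases he : e' = e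
      · subst he; simpa using h.1
      · simpa [he] using G.time_lt e'
  exists_in := by
    rintro (_ | v) h0 h1
    · exact ⟨some e, by simp⟩
    · obtain ⟨e', he'⟩ := G.exists_in v (fun hh => h0 (by rw [hh])) (fun hh => h1 (by rw [hh]))
      by_cases he : e' = e
      · exact ⟨none, by simp [← he, he']⟩
      · exact ⟨some e', by simp [he, he']⟩
  exists_out := by
    rintro (_ | v) h0 h1
    · exact ⟨none, rfl⟩
    · obtain ⟨e', he'⟩ := G.exists_out v (fun hh => h0 (by rw [hh])) (fun hh => h1 (by rw [hh]))
      exact ⟨some e', by simp [he']⟩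

/-- Adding a new edge `none` from `j` to `k`. -/
abbrev addEdge (G : TLG) (j k : G.V) (h : G.time j < G.time k) : TLG where
  V := G.V
  E := Option G.E
  finite_V := G.finite_V
  finite_E := by have := G.finite_E; infer_instance
  time := G.time
  first := G.first
  last := G.last
  src := fun o => o.elim j G.src
  tgt := fun o => o.elim k G.tgt
  time_first := G.time_first
  time_last := G.time_last
  time_pos := G.time_pos
  time_lt_one := G.time_lt_one
  time_lt := by
    rintro (_ | e)
    · exact h
    · exact G.time_lt e
  exists_in := fun v h0 h1 => by
    obtain ⟨e, he⟩ := G.exists_in v h0 h1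
    exact ⟨some e, he⟩
  exists_out := fun v h0 h1 => by
    obtain ⟨e, he⟩ := G.exists_out v h0 h1
    exact ⟨some e, he⟩

/-- Isomorphism of time-like graphs, i.e. relabelling of vertices and edges. -/
structure Iso (G H : TLG) where
  onV : G.V ≃ H.V
  onE : G.E ≃ H.E
  time_eq : ∀ v, H.time (onV v) = G.time v
  first_eq : onV G.first = H.first
  last_eq : onV G.last = H.last
  src_eq : ∀ e, H.src (onE e) = onV (G.src e)
  tgt_eq : ∀ e, H.tgt (onE e) = onV (G.tgt e)

/-- A TLG*-tower from the minimal graph to `G`: a finite sequence of steps, each of which adds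
a vertex on an edge, or adds an edge between two vertices connected by a time-path (or merely
renames vertices and edges). A time-like graph `G` is a TLG* if there is such a tower. -/
inductive Tower : TLG → Type 1
  | minimal : Tower TLG.minimal
  | addVertex {G : TLG} (T : Tower G) (e : G.E) (τ : ℝ)
      (h : G.time (G.src e) < τ ∧ τ < G.time (G.tgt e)) : Tower (G.addVertex e τ h)
  | addEdge {G : TLG} (T : Tower G) (j k : G.V) (h : G.time j < G.time k)
      (hpath : ∃ l, G.IsTimePath l j k) : Tower (G.addEdge j k h)
  | relabel {G H : TLG} (T : Tower G) (φ : Iso G H) : Tower H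

/-! ### Consistent representation of the steps

Each step identifies the points of the old graph with points of the new graph, and the full
time-paths of the old graph with full time-paths of the new graph. -/

open Classical in
/-- The points of `G` as points of the graph with a vertex added. -/
def addVertexPoint (G : TLG) (e : G.E) (τ : ℝ)
    (h : G.time (G.src e) < τ ∧ τ < G.time (G.tgt e)) : G.Point → (G.addVertex e τ h).Point
  | .vertex v => .vertex (some v)
  | .inner e' t _ =>
      if e' = e ∧ τ ≤ t then (G.addVertex e τ h).edgePoint none t
      else (G.addVertex e τ h).edgePoint (some e') t

/-- The points of `G` as points of the graph with an edge added. -/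
def addEdgePoint (G : TLG) (j k : G.V) (h : G.time j < G.time k) :
    G.Point → (G.addEdge j k h).Point
  | .vertex v => .vertex v
  | .inner e t ht => .inner (some e) t ht

/-- The points of `G` as points of an isomorphic graph. -/
def Iso.point {G H : TLG} (φ : Iso G H) : G.Point → H.Point
  | .vertex v => .vertex (φ.onV v)
  | .inner e t _ => H.edgePoint (φ.onE e) t

open Classical in
theorem isTimePath_addVertex (G : TLG) (e : G.E) (τ : ℝ)
    (h : G.time (G.src e) < τ ∧ τ < G.time (G.tgt e)) (l : List G.E) (u v : G.V)
    (hl : G.IsTimePath l u v) :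
    (G.addVertex e τ h).IsTimePath
      (l.flatMap fun e' => if e' = e then [some e, none] else [some e']) (some u) (some v) := by
  induction l generalizing u with
  | nil => exact congrArg some hl
  | cons a l ih =>
    obtain ⟨h1, h2⟩ := hl
    by_cases ha : a = e
    · subst ha
      rw [List.flatMap_cons, if_pos rfl]
      exact ⟨congrArg some h1, by simp [addVertex], ih _ h2⟩
    · rw [List.flatMap_cons, if_neg ha]
      refine ⟨congrArg some h1, ?_⟩
      have : (G.addVertex e τ h).tgt (some a) = some (G.tgt a) := by simp [addVertex, ha]
      rw [this]
      exact ih _ h2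

theorem isTimePath_addEdge (G : TLG) (j k : G.V) (h : G.time j < G.time k)
    (l : List G.E) (u v : G.V) (hl : G.IsTimePath l u v) :
    (G.addEdge j k h).IsTimePath (l.map some) u v := by
  induction l generalizing u with
  | nil => exact hl
  | cons a l ih => exact ⟨hl.1, ih _ hl.2⟩

theorem Iso.isTimePath {G H : TLG} (φ : Iso G H) (l : List G.E) (u v : G.V)
    (hl : G.IsTimePath l u v) : H.IsTimePath (l.map φ.onE) (φ.onV u) (φ.onV v) := by
  induction l generalizing u with
  | nil => exact congrArg φ.onV hl
  | cons a l ih =>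
    refine ⟨by rw [φ.src_eq, hl.1], ?_⟩
    rw [φ.tgt_eq]
    exact ih _ hl.2

open Classical in
/-- The full time-paths of `G` as full time-paths of the graph with a vertex added. -/
def addVertexPath (G : TLG) (e : G.E) (τ : ℝ)
    (h : G.time (G.src e) < τ ∧ τ < G.time (G.tgt e)) (σ : G.FullPath) :
    (G.addVertex e τ h).FullPath where
  edges := σ.edges.flatMap fun e' => if e' = e then [some e, none] else [some e']
  isTimePath := G.isTimePath_addVertex e τ h σ.edges _ _ σ.isTimePath

/-- The full time-paths of `G` as full time-paths of the graph with an edge added. -/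
def addEdgePath (G : TLG) (j k : G.V) (h : G.time j < G.time k) (σ : G.FullPath) :
    (G.addEdge j k h).FullPath where
  edges := σ.edges.map some
  isTimePath := G.isTimePath_addEdge j k h σ.edges _ _ σ.isTimePath

/-- The full time-paths of `G` as full time-paths of an isomorphic graph. -/
def Iso.path {G H : TLG} (φ : Iso G H) (σ : G.FullPath) : H.FullPath where
  edges := σ.edges.map φ.onE
  isTimePath := by
    rw [← φ.first_eq, ← φ.last_eq]
    exact φ.isTimePath σ.edges _ _ σ.isTimePath

/-- The only full time-path of the minimal graph. -/
def minimalPath : minimal.FullPath where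
  edges := [()]
  isTimePath := ⟨rfl, rfl⟩

end TLG

/-! ### Families of distributions along full time-paths -/

/-- Conditional independence of the σ-algebras `m₁` and `m₂` given the σ-algebra `m`. -/
def CondIndepGiven {Ω : Type*} [mΩ : MeasurableSpace Ω] (P : Measure Ω)
    (m m₁ m₂ : MeasurableSpace Ω) : Prop :=
  ∀ A B : Set Ω, MeasurableSet[m₁] A → MeasurableSet[m₂] B →
    P[(A ∩ B).indicator (fun _ => (1 : ℝ)) | m] =ᵐ[P]
      P[A.indicator (fun _ => (1 : ℝ)) | m] * P[B.indicator (fun _ => (1 : ℝ)) | m]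

/-- The σ-algebra generated by the random variables `Y i`, `i ∈ S`. -/
abbrev sigmaGen {Ω ι : Type*} (Y : ι → Ω → ℝ) (S : Set ι) : MeasurableSpace Ω :=
  ⨆ i ∈ S, MeasurableSpace.comap (Y i) inferInstance

/-- Right-continuity with left limits on `[0, 1]`. -/
def IsRCLL (f : Icc (0 : ℝ) 1 → ℝ) : Prop :=
  ∀ t, ContinuousWithinAt f (Ici t) t ∧ ∃ l, Tendsto f (𝓝[<] t) (𝓝 l)

/-- The space of RCLL paths on `[0, 1]`, with the σ-algebra generated by the coordinates
(the Borel σ-algebra of the Skorohod topology). It contains the continuous paths. -/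
abbrev PathSpace : Type := {f : Icc (0 : ℝ) 1 → ℝ // IsRCLL f}

/-- A probability measure on path space is the distribution of a Markov process: for every time,
the past and the future are conditionally independent given the present. -/
def IsMarkovLaw (μ : Measure PathSpace) : Prop :=
  ∀ t : Icc (0 : ℝ) 1,
    CondIndepGiven μ
      (sigmaGen (fun (s : Icc (0 : ℝ) 1) (y : PathSpace) => y.1 s) {t})
      (sigmaGen (fun (s : Icc (0 : ℝ) 1) (y : PathSpace) => y.1 s) (Iic t))
      (sigmaGen (fun (s : Icc (0 : ℝ) 1) (y : PathSpace) => y.1 s) (Ici t))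

namespace TLG

/-- A Markov family on `G`: for every full time-path a distribution of an RCLL (for example
continuous) Markov process, such that the distributions along any two full time-paths agree
on the set of times at which the two paths are at the same point of the graph. -/
structure IsMarkovFamily {G : TLG} (M : G.FullPath → Measure PathSpace) : Prop where
  isProbabilityMeasure : ∀ σ, IsProbabilityMeasure (M σ)
  consistent : ∀ σ₁ σ₂ : G.FullPath,
    (M σ₁).map (fun y (t : {t : Icc (0 : ℝ) 1 // σ₁.at t = σ₂.at t}) => y.1 t.1) =
      (M σ₂).map (fun y (t : {t : Icc (0 : ℝ) 1 // σ₁.at t = σ₂.at t}) => y.1 t.1)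
  isMarkovLaw : ∀ σ, IsMarkovLaw (M σ)

/-- The pair of values at the points `p` and `q`. -/
def evalPair {ι : Type*} (p q : ι) (x : ι → ℝ) : ℝ × ℝ := (x p, x q)

theorem measurable_evalPair {ι : Type*} (p q : ι) : Measurable (evalPair p q) :=
  (measurable_pi_apply p).prodMk (measurable_pi_apply q)

/-- `κ x y` is a regular version of the conditional distribution, under `μ`, of the path
restricted to `[a, b]`, given that it has the values `x` at time `a` and `y` at time `b`. -/
def IsBridgeKernel (μ : Measure PathSpace) (a b : Icc (0 : ℝ) 1)
    (κ : Kernel (ℝ × ℝ) (Icc a b → ℝ)) : Prop :=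
  μ.map (fun y => ((y.1 a, y.1 b), fun t : Icc a b => y.1 t.1)) =
    (μ.map (fun y => (y.1 a, y.1 b))) ⊗ₘ κ

/-- `X` is obtained by the inductive construction of the natural `M`-process along the tower.
* On the minimal graph `X` has the distribution prescribed by `M`.
* When a vertex is added, the process is the same on the same points.
* When an edge from `j` to `k` is added, some full time-path `σ` through the new edge is picked,
  together with a version `κ` of the conditional distribution of the `M σ`-process on
  `[time j, time k]` given its values at the endpoints; given the process `X'` on the
  old graph, the process on the new edge has the distribution `κ (X' j, X' k)`, so that it is
  otherwise independent of `X'`.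
In all cases the family on the old graph is the one induced by `M`. -/
def Tower.IsNatural {Ω : Type*} [MeasurableSpace Ω] (P : Measure Ω) :
    {G : TLG} → Tower G → (G.FullPath → Measure PathSpace) → (G.Point → Ω → ℝ) → Prop
  | _, .minimal, M, X =>
      P.map (fun ω (t : Icc (0 : ℝ) 1) => X (minimalPath.at t) ω) =
        (M minimalPath).map Subtype.val
  | _, @Tower.addVertex G T e τ h, M, X =>
      T.IsNatural P (fun σ => M (G.addVertexPath e τ h σ))
        (fun p => X (G.addVertexPoint e τ h p))
  | _, @Tower.addEdge G T j k h _, M, X =>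
      T.IsNatural P (fun σ => M (G.addEdgePath j k h σ)) (fun p => X (G.addEdgePoint j k h p)) ∧
      ∃ σ : (G.addEdge j k h).FullPath, none ∈ σ.edges ∧
      ∃ κ : Kernel (ℝ × ℝ) (Icc (G.unitTime j) (G.unitTime k) → ℝ), IsMarkovKernel κ ∧
        IsBridgeKernel (M σ) (G.unitTime j) (G.unitTime k) κ ∧
        P.map (fun ω => ((fun p : G.Point => X (G.addEdgePoint j k h p) ω),
            (fun t : Icc (G.unitTime j) (G.unitTime k) =>
              X ((G.addEdge j k h).edgePoint none (t.1 : ℝ)) ω))) =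
          (P.map (fun ω (p : G.Point) => X (G.addEdgePoint j k h p) ω)) ⊗ₘ
            (κ.comap (evalPair (.vertex j) (.vertex k)) (measurable_evalPair _ _))
  | _, @Tower.relabel _ _ T φ, M, X =>
      T.IsNatural P (fun σ => M (φ.path σ)) (fun p => X (φ.point p))

/-- The process `X` indexed by the points of `G` is time-Markovian: for every point `p`, the
process on the past of `p` and the process on the future of `p` are conditionally independent
given `X p`. -/
def IsTimeMarkovian {G : TLG} {Ω : Type*} [MeasurableSpace Ω] (P : Measure Ω)
    (X : G.Point → Ω → ℝ) : Prop :=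
  ∀ p : G.Point,
    CondIndepGiven P (sigmaGen X {p}) (sigmaGen X (past p)) (sigmaGen X (future p))

end TLG

end

/-! ### Conditional independence of σ-algebras -/

section CondIndepCalculus

variable {Ω : Type*} {m m₁ m₂ m₃ m' m₁' m₂' : MeasurableSpace Ω} {m₀ : MeasurableSpace Ω}
  {P : Measure Ω}

/-! The proof is an induction along the tower of two statements at once: along every full time-path
`σ` the process has the law `M σ` (`HasPathLaws`), and the process is time-Markovian. The first is
needed because the Markov property inside a newly added edge is read off the law along a full
time-path through that edge. Adding a vertex or relabelling only renames points and paths, so the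
substance is the addition of an edge E* from `j` to `k`.

Laws (`hasPathLaws_addEdge`): a full time-path σ' through E* has a bypass in the old graph
(`exists_bypass`), which follows an old time-path from `j` to `k` instead. Outside of E* the two
agree, so by induction and consistency the process has there the law prescribed by `M σ'`. On E* it
is drawn from a kernel of the two endpoint values alone. Under `M σ'` this is also true, since a
Markov process on [a, b] is independent of the rest given its values at a and b
(`IsMarkovLaw.condIndepGiven_Icc`), and by consistency the same kernel serves all paths through E*.
Equal marginals and equal kernels give equal laws.

Time-Markov property (`isTimeMarkovian_addEdge`): given the values at `j` and `k`, the new edge is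
independent of the old graph. For an old point p, the interior of E* joins the past only if k ≼ p
and the future only if p ≼ j, never both. The side that it joins already contains `j` and `k`, so E*
can be added there (`CondIndepGiven.sup_left`). For a point inside E*, the past is the past of `j`
with the initial piece of E*, and the future is the final piece with the future of `k`;
`CondIndepGiven.bridge` combines the Markov property on E* with the old one at `j` and at `k`.

The manipulations of σ-algebras use only symmetry, monotonicity, weak union and contraction; the
last two follow from the one-sided form `condIndepGiven_iff`. -/

theorem setIntegral_eq_of_isPiSystem {f g : Ω → ℝ} (hf : Integrable f P) (hg : Integrable g P)
    (hm : m ≤ m₀) {S : Set (Set Ω)}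
    (hS : m = MeasurableSpace.generateFrom S) (hpi : IsPiSystem S) (huniv : univ ∈ S)
    (h : ∀ s ∈ S, ∫ ω in s, f ω ∂P = ∫ ω in s, g ω ∂P) (s : Set Ω) (hs : MeasurableSet[m] s) :
    ∫ ω in s, f ω ∂P = ∫ ω in s, g ω ∂P := by
  have htot : ∫ ω, f ω ∂P = ∫ ω, g ω ∂P := by simpa using h univ huniv
  induction s, hs using MeasurableSpace.induction_on_inter hS hpi with
  | empty => simp
  | basic t ht => exact h t ht
  | compl t ht ih =>
    have h1 := integral_add_compl (hm t ht) hf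
    have h2 := integral_add_compl (hm t ht) hg
    linarith
  | iUnion t hd ht ih =>
    rw [integral_iUnion (fun i => hm _ (ht i)) hd hf.integrableOn,
      integral_iUnion (fun i => hm _ (ht i)) hd hg.integrableOn]
    exact tsum_congr ih

theorem isPiSystem_inter_measurableSet (m m' : MeasurableSpace Ω) :
    IsPiSystem {s | ∃ C B, MeasurableSet[m] C ∧ MeasurableSet[m'] B ∧ s = C ∩ B} := by
  rintro _ ⟨C, B, hC, hB, rfl⟩ _ ⟨C', B', hC', hB', rfl⟩ _
  exact ⟨C ∩ C', B ∩ B', hC.inter hC', hB.inter hB', inter_inter_inter_comm _ _ _ _⟩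

/-- The sets C ∩ B are the test sets on which integrals over members of a join of two σ-algebras are
compared. -/
theorem sup_eq_generateFrom_inter (m m' : MeasurableSpace Ω) :
    m ⊔ m' = MeasurableSpace.generateFrom
      {s | ∃ C B, MeasurableSet[m] C ∧ MeasurableSet[m'] B ∧ s = C ∩ B} := by
  apply le_antisymm
  · apply sup_le
    · intro s hs
      exact MeasurableSpace.measurableSet_generateFrom
        ⟨s, univ, hs, MeasurableSet.univ, (inter_univ s).symm⟩
    · intro s hs
      exact MeasurableSpace.measurableSet_generateFrom
        ⟨univ, s, MeasurableSet.univ, hs, (univ_inter s).symm⟩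
  · apply MeasurableSpace.generateFrom_le
    rintro _ ⟨C, B, hC, hB, rfl⟩
    exact MeasurableSet.inter ((le_sup_left : m ≤ m ⊔ m') _ hC)
      ((le_sup_right : m' ≤ m ⊔ m') _ hB)

theorem CondIndepGiven.symm (h : CondIndepGiven P m m₁ m₂) :
    CondIndepGiven P m m₂ m₁ := by
  intro A B hA hB
  rw [inter_comm, mul_comm]
  exact h B A hB hA

theorem CondIndepGiven.mono (h : CondIndepGiven P m m₁ m₂)
    (h₁ : m₁' ≤ m₁) (h₂ : m₂' ≤ m₂) : CondIndepGiven P m m₁' m₂' :=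
  fun A B hA hB => h A B (h₁ _ hA) (h₂ _ hB)

theorem norm_condExp_indicator_le (m : MeasurableSpace Ω) {A : Set Ω} :
    ∀ᵐ ω ∂P, ‖(P[A.indicator (fun _ => (1 : ℝ)) | m]) ω‖ ≤ 1 := by
  refine ae_bdd_abs_condExp_of_ae_bdd_abs (R := (1 : ℝ)) (ae_of_all _ fun ω => ?_)
  by_cases h : ω ∈ A <;> simp [h]

variable [IsProbabilityMeasure P]

theorem condIndepGiven_bot_left (hm : m ≤ m₀) :
    CondIndepGiven P m ⊥ m₂ := by
  intro A B hA _
  rcases (MeasurableSpace.measurableSet_bot_iff).1 hA with rfl | rfl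
  · refine ae_of_all _ fun ω => ?_
    simp
  · rw [univ_inter]
    refine ae_of_all _ fun ω => ?_
    simp [condExp_const hm (1 : ℝ)]

theorem integrable_indicator_one {A : Set Ω} (hA : MeasurableSet A) :
    Integrable (A.indicator fun _ => (1 : ℝ)) P :=
  (integrable_const _).indicator hA

theorem condExp_indicator_mul_left {A : Set Ω} (hA : MeasurableSet A) {f : Ω → ℝ} (hf : StronglyMeasurable[m] f)
    (hbd : ∀ᵐ ω ∂P, ‖f ω‖ ≤ 1) :
    P[f * A.indicator (fun _ => (1 : ℝ)) | m] =ᵐ[P]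
      f * P[A.indicator (fun _ => (1 : ℝ)) | m] := by
  -- If `m` is not a sub-σ-algebra, both conditional expectations are 0 by convention.
  by_cases hm : m ≤ m₀
  · refine condExp_mul_of_stronglyMeasurable_left hf ?_ (integrable_indicator_one hA)
    exact (integrable_indicator_one hA).bdd_mul (hf.mono hm).aestronglyMeasurable hbd
  · simp [condExp_of_not_le hm]

/-- Conditional independence, expressed by conditional probabilities given the larger
σ-algebra. -/
theorem condIndepGiven_iff (hm : m ≤ m₀) (h₁ : m₁ ≤ m₀)
    (h₂ : m₂ ≤ m₀) :
    CondIndepGiven P m m₁ m₂ ↔ ∀ A, MeasurableSet[m₁] A →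
      P[A.indicator (fun _ => (1 : ℝ)) | m ⊔ m₂] =ᵐ[P] P[A.indicator (fun _ => (1 : ℝ)) | m] := by
  have hsup : m ⊔ m₂ ≤ m₀ := sup_le hm h₂
  have hmul : ∀ A B : Set Ω, (A ∩ B).indicator (fun _ => (1 : ℝ)) =
      B.indicator (fun _ => (1 : ℝ)) * A.indicator (fun _ => (1 : ℝ)) := by
    intro A B
    ext ω
    by_cases hA : ω ∈ A <;> by_cases hB : ω ∈ B <;> simp [hA, hB]
  constructor
  · intro h A hA
    symm
    have hiA := integrable_indicator_one (P := P) (h₁ A hA)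
    -- The candidate for P(A | m ⊔ m₂) is P(A | m); it remains to compare integrals over the
    -- π-system of sets C ∩ B.
    have hsm : StronglyMeasurable[m ⊔ m₂] (P[A.indicator (fun _ => (1 : ℝ)) | m]) :=
      stronglyMeasurable_condExp.mono le_sup_left
    refine ae_eq_condExp_of_forall_setIntegral_eq hsup hiA
      (fun _ _ _ => integrable_condExp.integrableOn) (fun s hs _ => ?_)
      hsm.aestronglyMeasurable
    refine setIntegral_eq_of_isPiSystem integrable_condExp hiA hsup
      (sup_eq_generateFrom_inter m m₂) (isPiSystem_inter_measurableSet m m₂)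
      ⟨univ, univ, MeasurableSet.univ, MeasurableSet.univ, by simp⟩ ?_ s hs
    rintro _ ⟨C, B, hC, hB, rfl⟩
    have hiB := integrable_indicator_one (P := P) (h₂ B hB)
    have hset : ∀ f : Ω → ℝ, ∫ ω in C ∩ B, f ω ∂P
        = ∫ ω in C, (f * B.indicator (fun _ => (1 : ℝ))) ω ∂P := by
      intro f
      rw [← setIntegral_indicator (h₂ B hB)]
      congr 1
      ext ω
      by_cases hB' : ω ∈ B <;> simp [hB']
    rw [hset, hset]
    -- Given `m`, the product P(A | m) · 1_B has conditional expectation P(A | m) · P(B | m), which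
    -- is P(A ∩ B | m) by hypothesis; integrating over C gives the claim.
    have e1 := condExp_indicator_mul_left (P := P) (h₂ B hB)
      (stronglyMeasurable_condExp (m := m) (μ := P) (f := A.indicator (fun _ => (1 : ℝ))))
      (norm_condExp_indicator_le m)
    have e2 := (e1.trans (h A B hA hB).symm)
    have hint : Integrable (P[A.indicator (fun _ => (1 : ℝ)) | m] *
        B.indicator (fun _ => (1 : ℝ))) P :=
      hiB.bdd_mul integrable_condExp.aestronglyMeasurable (norm_condExp_indicator_le m)
    rw [← setIntegral_condExp hm hint hC,
      setIntegral_congr_ae (hm C hC) (e2.mono fun ω hω _ => hω),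
      setIntegral_condExp hm (integrable_indicator_one ((h₁ A hA).inter (h₂ B hB))) hC,
      hmul, mul_comm]
  · intro h A B hA hB
    have e0 : StronglyMeasurable[m ⊔ m₂] (B.indicator (fun _ => (1 : ℝ))) :=
      StronglyMeasurable.indicator (@stronglyMeasurable_const _ _ (m ⊔ m₂) _ _)
        ((le_sup_right : m₂ ≤ m ⊔ m₂) _ hB)
    have e1 := condExp_indicator_mul_left (P := P) (h₁ A hA) e0
      (ae_of_all _ fun ω => by by_cases h : ω ∈ B <;> simp [h])
    -- Condition first on the larger σ-algebra, where 1_B is known, then on `m`, where P(A | m) is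
    -- known.
    have e2 : P[(A ∩ B).indicator (fun _ => (1 : ℝ)) | m ⊔ m₂] =ᵐ[P]
        P[A.indicator (fun _ => (1 : ℝ)) | m] * B.indicator (fun _ => (1 : ℝ)) := by
      rw [hmul, mul_comm (P[A.indicator (fun _ => (1 : ℝ)) | m])]
      exact e1.trans ((ae_eq_refl _).mul (h A hA))
    have e3 := condExp_indicator_mul_left (P := P) (h₂ B hB)
      (stronglyMeasurable_condExp (m := m) (μ := P) (f := A.indicator (fun _ => (1 : ℝ))))
      (norm_condExp_indicator_le m)
    exact (condExp_condExp_of_le le_sup_left hsup).symm.trans ((condExp_congr_ae e2).trans e3)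

/-- `m ⊔ m'` lies between `m` and `m ⊔ m₂`, and the conditional probability of A is the same at both
ends; by the tower property it is the same in between. -/
theorem CondIndepGiven.weak_union
    (h : CondIndepGiven P m m₁ m₂) (hm : m ≤ m₀) (h₁ : m₁ ≤ m₀) (h₂ : m₂ ≤ m₀) (h' : m' ≤ m₂) :
    CondIndepGiven P (m ⊔ m') m₁ m₂ := by
  rw [condIndepGiven_iff (sup_le hm (h'.trans h₂)) h₁ h₂]
  intro A hA
  have h0 := (condIndepGiven_iff hm h₁ h₂).1 h A hA
  have e : m ⊔ m' ⊔ m₂ = m ⊔ m₂ := by rw [sup_assoc, sup_eq_right.2 h']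
  rw [e]
  have hs : m ⊔ m' ≤ m ⊔ m₂ := sup_le_sup_left h' _
  have e1 := (condExp_condExp_of_le (μ := P) (f := A.indicator (fun _ => (1 : ℝ)))
    hs (sup_le hm h₂)).symm.trans (condExp_congr_ae h0)
  rw [condExp_of_stronglyMeasurable (sup_le hm (h'.trans h₂))
    (stronglyMeasurable_condExp.mono le_sup_left) integrable_condExp] at e1
  exact h0.trans e1.symm

/-- In the one-sided form this is a chain of two equalities, from `m ⊔ m₂ ⊔ m₃` down to `m ⊔ m₂` and
then to `m`. -/
theorem CondIndepGiven.contraction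
    (h : CondIndepGiven P m m₁ m₂) (h' : CondIndepGiven P (m ⊔ m₂) m₁ m₃)
    (hm : m ≤ m₀) (h₁ : m₁ ≤ m₀) (h₂ : m₂ ≤ m₀) (h₃ : m₃ ≤ m₀) :
    CondIndepGiven P m m₁ (m₂ ⊔ m₃) := by
  rw [condIndepGiven_iff hm h₁ (sup_le h₂ h₃)]
  intro A hA
  rw [← sup_assoc]
  exact ((condIndepGiven_iff (sup_le hm h₂) h₁ h₃).1 h' A hA).trans
    ((condIndepGiven_iff hm h₁ h₂).1 h A hA)

/-- Change of variables: members of `m.comap f` are preimages, so both sides have the same integrals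
over them. -/
theorem condExp_map_comp {Ω' : Type*} {m : MeasurableSpace Ω'} {m₀' : MeasurableSpace Ω'}
    {f : Ω → Ω'} (hf : Measurable f) (hm : m ≤ m₀') {A : Set Ω'} (hA : MeasurableSet A) :
    P[(f ⁻¹' A).indicator (fun _ => (1 : ℝ)) | m.comap f] =ᵐ[P]
      ((P.map f)[A.indicator (fun _ => (1 : ℝ)) | m]) ∘ f := by
  have : IsProbabilityMeasure (P.map f) := Measure.isProbabilityMeasure_map hf.aemeasurable
  have hmc : m.comap f ≤ m₀ := (MeasurableSpace.comap_mono hm).trans hf.comap_le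
  symm
  have hint : Integrable (((P.map f)[A.indicator (fun _ => (1 : ℝ)) | m]) ∘ f) P :=
    (integrable_map_measure integrable_condExp.aestronglyMeasurable hf.aemeasurable).1
      integrable_condExp
  refine ae_eq_condExp_of_forall_setIntegral_eq hmc (integrable_indicator_one (hf hA))
    (fun _ _ _ => hint.integrableOn) ?_ ?_
  · rintro _ ⟨s, hs, rfl⟩ _
    have h3 := setIntegral_condExp hm (integrable_indicator_one (P := P.map f) hA) hs
    rw [setIntegral_map (hm s hs) integrable_condExp.aestronglyMeasurable hf.aemeasurable,
      setIntegral_map (hm s hs) (integrable_indicator_one hA).aestronglyMeasurable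
        hf.aemeasurable] at h3
    exact h3
  · exact (stronglyMeasurable_condExp.comp_measurable
      (comap_measurable f)).aestronglyMeasurable

/-- Conditional independence only depends on the joint distribution. -/
theorem condIndepGiven_map_iff {Ω' : Type*} {m m₁ m₂ : MeasurableSpace Ω'}
    {m₀' : MeasurableSpace Ω'} {f : Ω → Ω'} (hf : Measurable f) (hm : m ≤ m₀') (h₁ : m₁ ≤ m₀')
    (h₂ : m₂ ≤ m₀') :
    CondIndepGiven (P.map f) m m₁ m₂ ↔
      CondIndepGiven P (m.comap f) (m₁.comap f) (m₂.comap f) := by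
  have key : ∀ A B, MeasurableSet[m₁] A → MeasurableSet[m₂] B →
      ((P.map f)[(A ∩ B).indicator (fun _ => (1 : ℝ)) | m] =ᵐ[P.map f]
        (P.map f)[A.indicator (fun _ => (1 : ℝ)) | m] *
          (P.map f)[B.indicator (fun _ => (1 : ℝ)) | m] ↔
      P[(f ⁻¹' A ∩ f ⁻¹' B).indicator (fun _ => (1 : ℝ)) | m.comap f] =ᵐ[P]
        P[(f ⁻¹' A).indicator (fun _ => (1 : ℝ)) | m.comap f] *
          P[(f ⁻¹' B).indicator (fun _ => (1 : ℝ)) | m.comap f]) := by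
    intro A B hA hB
    have e := condExp_map_comp (P := P) hf hm ((h₁ A hA).inter (h₂ B hB))
    have eA := condExp_map_comp (P := P) hf hm (h₁ A hA)
    have eB := condExp_map_comp (P := P) hf hm (h₂ B hB)
    rw [preimage_inter] at e
    have hmeas : ∀ g : Ω' → ℝ, Measurable[m₀'] ((P.map f)[g | m]) := fun g =>
      (stronglyMeasurable_condExp.mono hm).measurable
    have hae := ae_map_iff (μ := P) hf.aemeasurable
      (measurableSet_eq_fun (hmeas ((A ∩ B).indicator fun _ => 1)) ((hmeas (A.indicator fun _ => 1)).mul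
        (hmeas (B.indicator fun _ => 1))))
    refine Iff.trans hae ⟨fun h => ?_, fun h => ?_⟩
    · exact e.trans (EventuallyEq.trans h (eA.mul eB).symm)
    · exact e.symm.trans (h.trans (eA.mul eB))
  constructor
  · rintro h _ _ ⟨A, hA, rfl⟩ ⟨B, hB, rfl⟩
    exact (key A B hA hB).1 (h A B hA hB)
  · intro h A B hA hB
    exact (key A B hA hB).2 (h _ _ ⟨A, hA, rfl⟩ ⟨B, hB, rfl⟩)

/-- If the past `A` and the future `N ⊔ B` are independent given `J`, and the past `A ⊔ N` and the
future `B` are independent given `K`, then `N` is independent of `A ⊔ B` given `J ⊔ K`. -/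
theorem CondIndepGiven.between {J K N A B : MeasurableSpace Ω} {m₀ : MeasurableSpace Ω}
    {P : Measure Ω} [IsProbabilityMeasure P]
    (hJ : CondIndepGiven P J A (N ⊔ B)) (hK : CondIndepGiven P K (A ⊔ N) B)
    (hA : A ≤ m₀) (hN : N ≤ m₀) (hB : B ≤ m₀) (hJA : J ≤ A) (hKB : K ≤ B) :
    CondIndepGiven P (J ⊔ K) N (A ⊔ B) := by
  have hJ₀ := hJA.trans hA
  have hK₀ := hKB.trans hB
  -- Two halves for contraction: N is independent of B given `J ⊔ K` (from `hK`, after adding `J` to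
  -- the condition), and of A once B is known as well (from `hJ`).
  have e1 : CondIndepGiven P (J ⊔ K) N B := by
    have := hK.symm.weak_union hK₀ hB (sup_le hA hN) (hJA.trans le_sup_left)
    rw [sup_comm J K]
    exact this.symm.mono le_sup_right le_rfl
  have e2 : CondIndepGiven P (J ⊔ K ⊔ B) N A := by
    have := hJ.weak_union hJ₀ hA (sup_le hN hB) (m' := K ⊔ B)
      (sup_le (hKB.trans le_sup_right) le_sup_right)
    rw [sup_assoc]
    exact this.symm.mono le_sup_left le_rfl
  rw [sup_comm A B]
  exact e1.contraction e2 (sup_le hJ₀ hK₀) hN hB hA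

/-- If `A` and `B` are independent given `Z`, and `Y` depends on the rest only through
`D ≤ A`, then `A ⊔ Y` and `B` are independent given `Z`. -/
theorem CondIndepGiven.sup_left {Z A B C D Y : MeasurableSpace Ω} {m₀ : MeasurableSpace Ω}
    {P : Measure Ω} [IsProbabilityMeasure P]
    (h : CondIndepGiven P Z A B) (hY : CondIndepGiven P D Y C) (hC : C ≤ m₀) (hY₀ : Y ≤ m₀)
    (hA : A ≤ C) (hB : B ≤ C) (hD : D ≤ A) (hZ : Z ≤ A) :
    CondIndepGiven P Z (A ⊔ Y) B := by
  have hA₀ := hA.trans hC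
  have := hY.weak_union (hD.trans hA₀) hY₀ hC hA
  rw [sup_eq_right.2 hD, ← sup_eq_right.2 hZ] at this
  exact (h.symm.contraction (this.mono le_rfl hB).symm (hZ.trans hA₀) (hB.trans hC) hA₀ hY₀).symm

/-- The Markov property inside a bridge `Y₁ ⊔ Y₂` that is attached at its endpoints `J` and `K` to
a process with past `A` and future `B`. -/
theorem CondIndepGiven.bridge {Z J K Y₁ Y₂ A B : MeasurableSpace Ω} {m₀ : MeasurableSpace Ω}
    {P : Measure Ω} [IsProbabilityMeasure P]
    (hZ : CondIndepGiven P Z Y₁ Y₂) (hY : CondIndepGiven P (J ⊔ K) (Y₁ ⊔ Y₂) (A ⊔ B))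
    (hJ : CondIndepGiven P J A B) (hK : CondIndepGiven P K A B)
    (hY₁ : Y₁ ≤ m₀) (hY₂ : Y₂ ≤ m₀) (hA : A ≤ m₀) (hB : B ≤ m₀) (hJA : J ≤ A) (hKB : K ≤ B)
    (hJY : J ≤ Y₁) (hKY : K ≤ Y₂) (hZ₁ : Z ≤ Y₁) (hZ₂ : Z ≤ Y₂) :
    CondIndepGiven P Z (A ⊔ Y₁) (B ⊔ Y₂) := by
  have hJ₀ := hJA.trans hA
  have hK₀ := hKB.trans hB
  have hZ₀ := hZ₁.trans hY₁
  have hY₀ : Y₁ ⊔ Y₂ ≤ m₀ := sup_le hY₁ hY₂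
  -- The old Markov property at `J`, contracted with the independence of the bridge, makes A
  -- independent of `B ⊔ Y₁ ⊔ Y₂` given `J`. Since `J ≤ Y₁`, weak union replaces the condition by
  -- `Y₁`.
  have hA' : CondIndepGiven P (Z ⊔ Y₁) A Y₂ := by
    have e := hY.weak_union (sup_le hJ₀ hK₀) hY₀ (sup_le hA hB) (m' := B) le_sup_right
    rw [sup_assoc, sup_eq_right.2 hKB] at e
    have e' := (hJ.contraction (e.symm.mono le_sup_left le_rfl) hJ₀ hA hB hY₀).weak_union
      hJ₀ hA (sup_le hB hY₀) (m' := Y₁) (le_sup_left.trans le_sup_right)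
    rw [sup_eq_right.2 hJY] at e'
    rw [sup_eq_right.2 hZ₁]
    exact e'.mono le_rfl (le_sup_right.trans le_sup_right)
  -- The mirror image at `K`, except that A is kept beside `Y₁`, as the last contraction requires.
  have hB' : CondIndepGiven P (Z ⊔ Y₂) B (A ⊔ Y₁) := by
    have e := hY.weak_union (sup_le hJ₀ hK₀) hY₀ (sup_le hA hB) (m' := A) le_sup_left
    rw [sup_comm J K, sup_assoc, sup_eq_right.2 hJA] at e
    have e' := (hK.symm.contraction (e.symm.mono le_sup_right le_rfl) hK₀ hB hA hY₀).weak_union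
      hK₀ hB (sup_le hA hY₀) (m' := Y₂) (le_sup_right.trans le_sup_right)
    rw [sup_eq_right.2 hKY] at e'
    rw [sup_eq_right.2 hZ₂]
    exact e'.mono le_rfl (sup_le_sup_left le_sup_left _)
  have e := hZ.symm.contraction hA'.symm hZ₀ hY₂ hY₁ hA
  rw [sup_comm] at e
  rw [sup_comm B]
  exact e.symm.contraction hB'.symm hZ₀ (sup_le hA hY₁) hY₂ hB

end CondIndepCalculus

/-! ### Conditional independence and kernels -/

section KernelCondIndep

variable {Ω α β γ : Type*} {m₀ : MeasurableSpace Ω} {mα : MeasurableSpace α}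
  {mβ : MeasurableSpace β} {mγ : MeasurableSpace γ} {P : Measure Ω} [IsProbabilityMeasure P]
  {f : Ω → α} {g : Ω → β}

theorem map_prodMk_eq_compProd_iff (hf : Measurable f) (hg : Measurable g) (η : Kernel α β)
    [IsMarkovKernel η] :
    P.map (fun ω => (f ω, g ω)) = P.map f ⊗ₘ η ↔
      ∀ B A, MeasurableSet B → MeasurableSet A →
        P (f ⁻¹' B ∩ g ⁻¹' A) = ∫⁻ ω in f ⁻¹' B, η (f ω) A ∂P := by
  have : IsProbabilityMeasure (P.map f) := Measure.isProbabilityMeasure_map hf.aemeasurable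
  have : IsProbabilityMeasure (P.map (fun ω => (f ω, g ω))) :=
    Measure.isProbabilityMeasure_map (hf.prodMk hg).aemeasurable
  rw [Measure.ext_prod_iff]
  refine forall_congr' fun B => forall_congr' fun A => forall_congr' fun hB =>
    forall_congr' fun hA => ?_
  rw [Measure.map_apply (hf.prodMk hg) (hB.prod hA), Measure.compProd_apply_prod hB hA,
    setLIntegral_map hB (η.measurable_coe hA) hf]
  rfl

theorem condExp_of_map_prodMk_eq_compProd (hf : Measurable f) (hg : Measurable g)
    (η : Kernel α β) [IsMarkovKernel η]
    (h : P.map (fun ω => (f ω, g ω)) = P.map f ⊗ₘ η) {A : Set β} (hA : MeasurableSet A) :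
    P[(g ⁻¹' A).indicator (fun _ => (1 : ℝ)) | mα.comap f] =ᵐ[P]
      fun ω => (η (f ω) A).toReal := by
  symm
  have hmeas : Measurable fun ω => (η (f ω) A).toReal :=
    ((η.measurable_coe hA).comp hf).ennreal_toReal
  have hint : Integrable (fun ω => (η (f ω) A).toReal) P := by
    refine Integrable.of_bound hmeas.aestronglyMeasurable 1 (ae_of_all _ fun ω => ?_)
    rw [Real.norm_of_nonneg ENNReal.toReal_nonneg]
    exact ENNReal.toReal_le_of_le_ofReal zero_le_one (by simpa using prob_le_one)
  refine ae_eq_condExp_of_forall_setIntegral_eq hf.comap_le (integrable_indicator_one (hg hA))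
    (fun _ _ _ => hint.integrableOn) ?_ ?_
  · rintro _ ⟨B, hB, rfl⟩ _
    have hη : Measurable fun ω => η (f ω) A := (η.measurable_coe hA).comp hf
    rw [integral_toReal hη.aemeasurable (ae_of_all _ fun ω => measure_lt_top _ _),
      ← (map_prodMk_eq_compProd_iff hf hg η).1 h B A hB hA, integral_indicator (hg hA), Measure.restrict_restrict (hg hA)]
    simp [Measure.real, inter_comm]
  · have : Measurable[mα.comap f] fun ω => (η (f ω) A).toReal :=
      ((η.measurable_coe hA).comp (comap_measurable f)).ennreal_toReal
    exact this.stronglyMeasurable.aestronglyMeasurable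

/-- The conditional probability given `f` is a function of `ev ∘ f` already, so by the tower
property it is also the one given `ev ∘ f`. -/
theorem condIndepGiven_of_map_prodMk_eq_compProd (hf : Measurable f) (hg : Measurable g)
    {ev : α → γ} (hev : Measurable ev) (κ : Kernel γ β) [IsMarkovKernel κ]
    (h : P.map (fun ω => (f ω, g ω)) = P.map f ⊗ₘ κ.comap ev hev) :
    CondIndepGiven P (mγ.comap fun ω => ev (f ω)) (mβ.comap g) (mα.comap f) := by
  have hle : (mγ.comap fun ω => ev (f ω)) ≤ mα.comap f :=
    (hev.comp (comap_measurable f)).comap_le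
  rw [condIndepGiven_iff (hle.trans hf.comap_le) hg.comap_le hf.comap_le]
  rintro _ ⟨A, hA, rfl⟩
  rw [sup_eq_right.2 hle]
  have e := condExp_of_map_prodMk_eq_compProd hf hg _ h hA
  refine e.trans ((condExp_condExp_of_le hle hf.comap_le).symm.trans
    ((condExp_congr_ae e).trans ?_)).symm
  have hmeas : Measurable[mγ.comap fun ω => ev (f ω)]
      fun ω => ((κ.comap ev hev) (f ω) A).toReal :=
    ((κ.measurable_coe hA).comp (comap_measurable fun ω => ev (f ω))).ennreal_toReal
  rw [condExp_of_stronglyMeasurable (hle.trans hf.comap_le) hmeas.stronglyMeasurable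
    (integrable_condExp.congr e)]

/-- Converse direction: under conditional independence, knowing all of `f` does not change the
conditional law given `ev ∘ f`, so a disintegration over the latter is one over the former. -/
theorem map_prodMk_eq_compProd_of_condIndepGiven (hf : Measurable f) (hg : Measurable g)
    {ev : α → γ} (hev : Measurable ev) (κ : Kernel γ β) [IsMarkovKernel κ]
    (h : P.map (fun ω => (ev (f ω), g ω)) = P.map (fun ω => ev (f ω)) ⊗ₘ κ)
    (hCI : CondIndepGiven P (mγ.comap fun ω => ev (f ω)) (mβ.comap g) (mα.comap f)) :
    P.map (fun ω => (f ω, g ω)) = P.map f ⊗ₘ κ.comap ev hev := by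
  have hle : (mγ.comap fun ω => ev (f ω)) ≤ mα.comap f :=
    (hev.comp (comap_measurable f)).comap_le
  rw [map_prodMk_eq_compProd_iff hf hg]
  intro B A hB hA
  have hκ : Measurable fun ω => κ (ev (f ω)) A := (κ.measurable_coe hA).comp (hev.comp hf)
  have e1 : P[(g ⁻¹' A).indicator (fun _ => (1 : ℝ)) | mγ.comap fun ω => ev (f ω)] =ᵐ[P]
      fun ω => (κ (ev (f ω)) A).toReal :=
    condExp_of_map_prodMk_eq_compProd (hev.comp hf) hg κ h hA
  have e2 := (condIndepGiven_iff (hle.trans hf.comap_le) hg.comap_le hf.comap_le).1 hCI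
    (g ⁻¹' A) ⟨A, hA, rfl⟩
  rw [sup_eq_right.2 hle] at e2
  have e3 := setIntegral_condExp hf.comap_le (integrable_indicator_one (P := P) (hg hA))
    (s := f ⁻¹' B) ⟨B, hB, rfl⟩
  rw [setIntegral_congr_ae (hf hB) ((e2.trans e1).mono fun ω hω _ => hω),
    integral_toReal hκ.aemeasurable (ae_of_all _ fun ω => measure_lt_top _ _), integral_indicator (hg hA),
    Measure.restrict_restrict (hg hA)] at e3
  have hfin : ∫⁻ ω in f ⁻¹' B, κ (ev (f ω)) A ∂P ≠ ⊤ := by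
    refine ((setLIntegral_mono measurable_const fun ω _ => prob_le_one).trans_lt ?_).ne
    simp
  have e4 : P.real (g ⁻¹' A ∩ f ⁻¹' B) =
      (∫⁻ ω in f ⁻¹' B, κ (ev (f ω)) A ∂P).toReal := by
    rw [e3]
    simp
  rw [inter_comm]
  exact (ENNReal.toReal_eq_toReal_iff' (measure_ne_top _ _) hfin).1 e4

/-- The part of `f` that the kernel ignores can be discarded: test on preimages under `r`. -/
theorem map_prodMk_eq_compProd_of_comp {δ : Type*} {mδ : MeasurableSpace δ} (hf : Measurable f)
    (hg : Measurable g) {r : α → δ} (hr : Measurable r) {ev : δ → γ} (hev : Measurable ev)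
    (κ : Kernel γ β) [IsMarkovKernel κ]
    (h : P.map (fun ω => (f ω, g ω)) = P.map f ⊗ₘ κ.comap (fun x => ev (r x)) (hev.comp hr)) :
    P.map (fun ω => (r (f ω), g ω)) = P.map (fun ω => r (f ω)) ⊗ₘ κ.comap ev hev := by
  refine (map_prodMk_eq_compProd_iff (hr.comp hf) hg _).2 ?_
  intro B A hB hA
  exact (map_prodMk_eq_compProd_iff hf hg _).1 h (r ⁻¹' B) A (hr hB) hA

end KernelCondIndep

/-! ### σ-algebras generated by families of random variables -/

section SigmaGen

variable {Ω ι : Type*}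

theorem sigmaGen_mono {Y : ι → Ω → ℝ} {S T : Set ι} (h : S ⊆ T) : sigmaGen Y S ≤ sigmaGen Y T :=
  biSup_mono h

theorem sigmaGen_le {Y : ι → Ω → ℝ} {S : Set ι} {m : MeasurableSpace Ω}
    (h : ∀ i ∈ S, Measurable[m] (Y i)) : sigmaGen Y S ≤ m :=
  iSup₂_le fun i hi => (h i hi).comap_le

theorem sigmaGen_union (Y : ι → Ω → ℝ) (S T : Set ι) :
    sigmaGen Y (S ∪ T) = sigmaGen Y S ⊔ sigmaGen Y T :=
  iSup_union

theorem sigmaGen_image {κ : Type*} (Y : ι → Ω → ℝ) (f : κ → ι) (S : Set κ) :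
    sigmaGen Y (f '' S) = sigmaGen (fun k => Y (f k)) S :=
  iSup_image

theorem sigmaGen_empty (Y : ι → Ω → ℝ) : sigmaGen Y ∅ = ⊥ := by
  simp [sigmaGen]

theorem comap_sigmaGen {Ω' : Type*} (f : Ω' → Ω) (Y : ι → Ω → ℝ) (S : Set ι) :
    (sigmaGen Y S).comap f = sigmaGen (fun i ω => Y i (f ω)) S := by
  simp only [sigmaGen, MeasurableSpace.comap_iSup, MeasurableSpace.comap_comp]
  rfl

theorem comap_pi_eq_sigmaGen (Y : ι → Ω → ℝ) :
    MeasurableSpace.comap (fun ω i => Y i ω) MeasurableSpace.pi = sigmaGen Y univ := by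
  simp only [sigmaGen, MeasurableSpace.pi, MeasurableSpace.comap_iSup, MeasurableSpace.comap_comp,
    mem_univ, iSup_pos]
  rfl

theorem comap_pi_subtype_eq_sigmaGen (Y : ι → Ω → ℝ) (S : Set ι) :
    MeasurableSpace.comap (fun ω (i : S) => Y i ω) MeasurableSpace.pi = sigmaGen Y S := by
  rw [comap_pi_eq_sigmaGen (fun (i : S) => Y i), ← sigmaGen_image Y Subtype.val univ]
  simp

theorem comap_evalPair_eq_sigmaGen (Y : ι → Ω → ℝ) (i j : ι) :
    MeasurableSpace.comap (fun ω => (Y i ω, Y j ω)) inferInstance = sigmaGen Y {i, j} := by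
  rw [show (inferInstance : MeasurableSpace (ℝ × ℝ)) =
    MeasurableSpace.prod inferInstance inferInstance from rfl, MeasurableSpace.comap_prodMk,
    sigmaGen, iSup_insert, iSup_singleton]

end SigmaGen

namespace TLG

/-! ### Time-paths -/

section Paths

variable {G : TLG}

theorem edgePoint_of_lt {e : G.E} {t : ℝ} (h : G.time (G.src e) < t ∧ t < G.time (G.tgt e)) :
    G.edgePoint e t = .inner e t h :=
  dif_pos h

theorem edgePoint_of_le {e : G.E} {t : ℝ} (h : t ≤ G.time (G.src e)) :
    G.edgePoint e t = .vertex (G.src e) := by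
  rw [edgePoint, dif_neg fun h' => h'.1.not_ge h, if_pos h]

theorem edgePoint_of_ge {e : G.E} {t : ℝ} (h : G.time (G.tgt e) ≤ t) :
    G.edgePoint e t = .vertex (G.tgt e) := by
  rw [edgePoint, dif_neg fun h' => h'.2.not_ge h, if_neg]
  exact fun h' => absurd (G.time_lt e) (h.trans h').not_gt

theorem IsTimePath.time_le {l : List G.E} {u v : G.V} (h : G.IsTimePath l u v) :
    G.time u ≤ G.time v := by
  induction l generalizing u with
  | nil => exact le_of_eq (congrArg G.time h)
  | cons e l ih =>
    rw [← h.1]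
    exact (G.time_lt e).le.trans (ih h.2)

theorem isTimePath_append {l₁ l₂ : List G.E} {u w : G.V} :
    G.IsTimePath (l₁ ++ l₂) u w ↔ ∃ v, G.IsTimePath l₁ u v ∧ G.IsTimePath l₂ v w := by
  induction l₁ generalizing u with
  | nil => simp [IsTimePath]
  | cons e l ih => simp [IsTimePath, ih, and_assoc]

theorem IsTimePath.time_mem {l : List G.E} {u v : G.V} (h : G.IsTimePath l u v) {e : G.E}
    (he : e ∈ l) : G.time u ≤ G.time (G.src e) ∧ G.time (G.tgt e) ≤ G.time v := by
  obtain ⟨a, b, rfl⟩ := List.append_of_mem he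
  obtain ⟨w, ha, hw, hb⟩ := isTimePath_append.1 h
  exact ⟨hw ▸ ha.time_le, hb.time_le⟩

theorem pathPoint_of_le {l : List G.E} {u v : G.V} (h : G.IsTimePath l u v) {t : ℝ}
    (ht : t ≤ G.time u) : G.pathPoint l u t = .vertex u := by
  cases l with
  | nil => rfl
  | cons e l =>
    obtain ⟨rfl, _⟩ := h
    rw [pathPoint, if_pos (ht.trans_lt (G.time_lt e)), edgePoint_of_le ht]

theorem pathPoint_of_ge {l : List G.E} {u v : G.V} (h : G.IsTimePath l u v) {t : ℝ}
    (ht : G.time v ≤ t) : G.pathPoint l u t = .vertex v := by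
  induction l generalizing u with
  | nil => exact congrArg Point.vertex h
  | cons e l ih =>
    rw [pathPoint, if_neg (h.2.time_le.trans ht).not_gt]
    exact ih h.2

theorem pathPoint_append_of_ge {l₁ : List G.E} (l₂ : List G.E) {u v : G.V}
    (h : G.IsTimePath l₁ u v) {t : ℝ} (ht : G.time v ≤ t) :
    G.pathPoint (l₁ ++ l₂) u t = G.pathPoint l₂ v t := by
  induction l₁ generalizing u with
  | nil => rw [List.nil_append, show u = v from h]
  | cons e l ih =>
    rw [List.cons_append, pathPoint, if_neg (h.2.time_le.trans ht).not_gt]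
    exact ih h.2

theorem pathPoint_append_of_le {l₁ l₂ : List G.E} {u v w : G.V}
    (h : G.IsTimePath l₁ u v) (h' : G.IsTimePath l₂ v w) {t : ℝ} (ht : t ≤ G.time v) :
    G.pathPoint (l₁ ++ l₂) u t = G.pathPoint l₁ u t := by
  induction l₁ generalizing u with
  | nil =>
    obtain rfl : u = v := h
    rw [List.nil_append, pathPoint_of_le h' ht]
    rfl
  | cons e l ih =>
    rw [List.cons_append, pathPoint, pathPoint, ih h.2]

theorem time_pathPoint {l : List G.E} {u v : G.V} (h : G.IsTimePath l u v) {t : ℝ}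
    (h₁ : G.time u ≤ t) (h₂ : t ≤ G.time v) : (G.pathPoint l u t).time = t := by
  induction l generalizing u with
  | nil =>
    obtain rfl : u = v := h
    exact le_antisymm h₁ h₂
  | cons e l ih =>
    obtain ⟨rfl, h⟩ := h
    rw [pathPoint]
    split_ifs with ht
    · rcases h₁.eq_or_lt with h₁ | h₁
      · rw [edgePoint_of_le h₁.ge]
        exact h₁
      · rw [edgePoint_of_lt ⟨h₁, ht⟩]
        rfl
    · exact ih h (not_lt.1 ht)

theorem exists_append_of_pathPoint_eq_vertex {l : List G.E} {u v w : G.V}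
    (h : G.IsTimePath l u v) {t : ℝ} (ht : G.pathPoint l u t = .vertex w) :
    ∃ l₁ l₂, l = l₁ ++ l₂ ∧ G.IsTimePath l₁ u w ∧ G.IsTimePath l₂ w v := by
  induction l generalizing u with
  | nil =>
    obtain rfl : u = w := by simpa [pathPoint] using ht
    exact ⟨[], [], rfl, rfl, h⟩
  | cons e l ih =>
    rw [pathPoint] at ht
    split_ifs at ht with h'
    -- Strictly inside an edge the point is not a vertex, so here the vertex can only be the start
    -- of the edge.
    · have hle : t ≤ G.time (G.src e) := by
        by_contra hcon
        rw [edgePoint_of_lt ⟨not_le.1 hcon, h'⟩] at ht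
        cases ht
      rw [edgePoint_of_le hle, h.1] at ht
      obtain rfl : u = w := by simpa using ht
      exact ⟨[], e :: l, rfl, rfl, h⟩
    · obtain ⟨l₁, l₂, rfl, h₁, h₂⟩ := ih h.2 ht
      exact ⟨e :: l₁, l₂, rfl, ⟨h.1, h₁⟩, h₂⟩

theorem FullPath.ext_edges {σ₁ σ₂ : G.FullPath} (h : σ₁.edges = σ₂.edges) : σ₁ = σ₂ := by
  cases σ₁
  cases σ₂
  cases h
  rfl

theorem FullPath.time_at (σ : G.FullPath) (t : Icc (0 : ℝ) 1) : (σ.at t).time = t :=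
  time_pathPoint σ.isTimePath (by rw [G.time_first]; exact t.2.1)
    (by rw [G.time_last]; exact t.2.2)

theorem FullPath.at_injective (σ : G.FullPath) : Function.Injective σ.at := fun s t h =>
  Subtype.ext (by rw [← σ.time_at s, h, σ.time_at t])

/-- `p ≼ q` if and only if some full time-path passes through `p` and then through `q`. -/
theorem Point.le_iff {p q : G.Point} :
    p.Le q ↔ ∃ (σ : G.FullPath) (s t : Icc (0 : ℝ) 1), s ≤ t ∧ σ.at s = p ∧ σ.at t = q := by
  constructor
  · rintro ⟨h, σ, ⟨s, rfl⟩, ⟨t, rfl⟩⟩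
    rw [σ.time_at, σ.time_at] at h
    exact ⟨σ, s, t, h, rfl, rfl⟩
  · rintro ⟨σ, s, t, h, rfl, rfl⟩
    refine ⟨?_, σ, ⟨s, rfl⟩, ⟨t, rfl⟩⟩
    rw [σ.time_at, σ.time_at]
    exact h

/-- Two full time-paths that pass through the same vertex can be spliced there. -/
theorem FullPath.exists_splice {σ₁ σ₂ : G.FullPath} {v : G.V} {s t : Icc (0 : ℝ) 1}
    (h₁ : σ₁.at s = .vertex v) (h₂ : σ₂.at t = .vertex v) :
    ∃ σ : G.FullPath, (∀ r ≤ G.unitTime v, σ.at r = σ₁.at r) ∧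
      ∀ r, G.unitTime v ≤ r → σ.at r = σ₂.at r := by
  obtain ⟨a, b, hab, ha, hb⟩ := exists_append_of_pathPoint_eq_vertex σ₁.isTimePath h₁
  obtain ⟨c, d, hcd, hc, hd⟩ := exists_append_of_pathPoint_eq_vertex σ₂.isTimePath h₂
  refine ⟨⟨a ++ d, isTimePath_append.2 ⟨v, ha, hd⟩⟩, fun r hr => ?_, fun r hr => ?_⟩
  · rw [FullPath.at, FullPath.at, hab, pathPoint_append_of_le ha hd hr,
      pathPoint_append_of_le ha hb hr]
  · rw [FullPath.at, FullPath.at, hcd, pathPoint_append_of_ge d ha hr,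
      pathPoint_append_of_ge d hc hr]

end Paths

/-! ### Adding a vertex -/

section AddVertex

variable {G : TLG} {e : G.E} {τ : ℝ} {h : G.time (G.src e) < τ ∧ τ < G.time (G.tgt e)}

open Classical in
theorem addVertexPoint_edgePoint (e' : G.E) (t : ℝ) :
    G.addVertexPoint e τ h (G.edgePoint e' t) =
      if e' = e ∧ τ ≤ t then (G.addVertex e τ h).edgePoint none t
      else (G.addVertex e τ h).edgePoint (some e') t := by
  rcases le_or_gt t (G.time (G.src e')) with h₁ | h₁
  · rw [edgePoint_of_le h₁, if_neg, edgePoint_of_le (show t ≤ (G.addVertex e τ h).time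
      ((G.addVertex e τ h).src (some e')) from h₁)]
    · rfl
    · rintro ⟨rfl, h'⟩
      exact absurd h.1 (h'.trans h₁).not_gt
  rcases le_or_gt (G.time (G.tgt e')) t with h₂ | h₂
  · rw [edgePoint_of_ge h₂]
    split_ifs with h'
    · obtain ⟨rfl, h'⟩ := h'
      exact (edgePoint_of_ge (G := G.addVertex e' τ h) (e := none) h₂).symm
    · have hne : e' ≠ e := by
        rintro rfl
        exact h' ⟨rfl, h.2.le.trans h₂⟩
      rw [edgePoint_of_ge (G := G.addVertex e τ h) (e := some e') (by simpa [hne] using h₂)]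
      simp [hne, addVertexPoint]
  · rw [edgePoint_of_lt ⟨h₁, h₂⟩]
    rfl

theorem addVertexPath_at (σ : G.FullPath) (t : Icc (0 : ℝ) 1) :
    (G.addVertexPath e τ h σ).at t = G.addVertexPoint e τ h (σ.at t) := by
  classical
  have key : ∀ (l : List G.E) (u : G.V) (t : ℝ), (G.addVertex e τ h).pathPoint
      (l.flatMap fun e' => if e' = e then [some e, none] else [some e']) (some u) t =
      G.addVertexPoint e τ h (G.pathPoint l u t) := by
    intro l
    induction l with
    | nil => intro u t; rfl
    | cons e' l ih =>
      intro u t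
      rw [List.flatMap_cons, pathPoint]
      by_cases he : e' = e
      · subst he
        simp only [if_true, List.cons_append, List.nil_append, pathPoint]
        have := ih (G.tgt e') t
        simp only [Option.elim] at this ⊢
        rw [this]
        simp only [apply_ite (G.addVertexPoint e' τ h), addVertexPoint_edgePoint]
        by_cases h₁ : t < τ
        · simp [h₁, h₁.trans h.2, h₁.not_ge]
        · simp only [h₁, not_lt.1 h₁, and_self, if_true, if_false]
          exact if_congr Iff.rfl rfl rfl
      · simp only [he, if_false, List.cons_append, List.nil_append, pathPoint]
        have := ih (G.tgt e') t
        simp only [Option.elim, he, if_false] at this ⊢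
        rw [this]
        simp only [apply_ite (G.addVertexPoint e τ h), addVertexPoint_edgePoint, he, false_and,
          if_false]
  exact key σ.edges G.first t

theorem addVertexPath_surjective : Function.Surjective (G.addVertexPath e τ h) := by
  classical
  -- Simultaneous induction for paths starting at an old vertex and at the new vertex: after the
  -- first half of `e` the path is at the new vertex, whose only outgoing edge is the second half.
  have key : ∀ (l : List (Option G.E)) (v : G.V),
      (∀ u, (G.addVertex e τ h).IsTimePath l (some u) (some v) → ∃ l', G.IsTimePath l' u v ∧
        l'.flatMap (fun e' => if e' = e then [some e, none] else [some e']) = l) ∧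
      ((G.addVertex e τ h).IsTimePath l none (some v) → ∃ l', G.IsTimePath l' (G.tgt e) v ∧
        none :: l'.flatMap (fun e' => if e' = e then [some e, none] else [some e']) = l) := by
    intro l v
    induction l with
    | nil =>
      refine ⟨fun u hu => ⟨[], by simpa [IsTimePath] using hu, rfl⟩, fun hu => ?_⟩
      simp [IsTimePath] at hu
    | cons a l ih =>
      rcases a with _ | a
      · refine ⟨fun u hu => by simp [IsTimePath] at hu, fun hu => ?_⟩
        obtain ⟨l', h₁, h₂⟩ := ih.1 _ hu.2
        exact ⟨l', h₁, by rw [h₂]⟩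
      · refine ⟨fun u hu => ?_, fun hu => by simp [IsTimePath] at hu⟩
        obtain ⟨h₀, hu⟩ := hu
        replace h₀ : G.src a = u := Option.some.inj h₀
        by_cases ha : a = e
        · subst ha
          obtain ⟨l', h₁, h₂⟩ := ih.2 (by simpa using hu)
          exact ⟨a :: l', ⟨h₀, h₁⟩, by simp [← h₂]⟩
        · obtain ⟨l', h₁, h₂⟩ := ih.1 (G.tgt a) (by simpa [ha] using hu)
          exact ⟨a :: l', ⟨h₀, h₁⟩, by simp [← h₂, ha]⟩
  intro σ
  obtain ⟨l, h₁, h₂⟩ := (key σ.edges G.last).1 _ σ.isTimePath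
  exact ⟨⟨l, h₁⟩, FullPath.ext_edges h₂⟩

theorem addVertexPoint_injective : Function.Injective (G.addVertexPoint e τ h) := by
  classical
  -- The left inverse glues the two halves of `e` together again; the new vertex returns to the
  -- interior point of `e` at time `τ`.
  let inv : (G.addVertex e τ h).Point → G.Point := fun p => match p with
    | .vertex none => .inner e τ h
    | .vertex (some v) => .vertex v
    | .inner none t _ => G.edgePoint e t
    | .inner (some e') t _ => G.edgePoint e' t
  refine Function.LeftInverse.injective (g := inv) ?_
  rintro (v | ⟨e', t, ht⟩)
  · rfl
  · rw [addVertexPoint]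
    split_ifs with h'
    · obtain ⟨rfl, h'⟩ := h'
      rcases h'.eq_or_lt with rfl | h'
      · have hv : (G.addVertex e' τ h).edgePoint none τ = .vertex none :=
          edgePoint_of_le (G := G.addVertex e' τ h) (e := none) le_rfl
        rw [hv]
      · rw [edgePoint_of_lt (G := G.addVertex e' τ h) (e := none) ⟨h', ht.2⟩]
        exact edgePoint_of_lt ht
    · rw [edgePoint_of_lt (G := G.addVertex e τ h) (e := some e') ⟨ht.1, ?_⟩]
      · exact edgePoint_of_lt ht
      · by_cases he : e' = e
        · have : t < τ := not_le.1 fun h'' => h' ⟨he, h''⟩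
          simpa [he] using this
        · simpa [he] using ht.2

end AddVertex

/-! ### Relabelling -/

namespace Iso

variable {G H : TLG} (φ : Iso G H)

theorem point_edgePoint (e : G.E) (t : ℝ) :
    φ.point (G.edgePoint e t) = H.edgePoint (φ.onE e) t := by
  have hs : H.time (H.src (φ.onE e)) = G.time (G.src e) := by rw [φ.src_eq, φ.time_eq]
  have ht : H.time (H.tgt (φ.onE e)) = G.time (G.tgt e) := by rw [φ.tgt_eq, φ.time_eq]
  rcases le_or_gt t (G.time (G.src e)) with h₁ | h₁
  · rw [edgePoint_of_le h₁, edgePoint_of_le (hs ▸ h₁), φ.src_eq]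
    rfl
  rcases le_or_gt (G.time (G.tgt e)) t with h₂ | h₂
  · rw [edgePoint_of_ge h₂, edgePoint_of_ge (ht ▸ h₂), φ.tgt_eq]
    rfl
  · rw [edgePoint_of_lt ⟨h₁, h₂⟩]
    rfl

theorem path_at (σ : G.FullPath) (t : Icc (0 : ℝ) 1) : (φ.path σ).at t = φ.point (σ.at t) := by
  have key : ∀ (l : List G.E) (u : G.V) (t : ℝ),
      H.pathPoint (l.map φ.onE) (φ.onV u) t = φ.point (G.pathPoint l u t) := by
    intro l
    induction l with
    | nil => intro u t; rfl
    | cons e l ih =>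
      intro u t
      rw [List.map_cons, pathPoint, pathPoint, φ.tgt_eq, φ.time_eq, ih, ← point_edgePoint,
        ← apply_ite φ.point]
  rw [FullPath.at, ← φ.first_eq]
  exact key σ.edges G.first t

/-- The inverse relabelling. -/
def symm : Iso H G where
  onV := φ.onV.symm
  onE := φ.onE.symm
  time_eq v := by rw [← φ.time_eq, Equiv.apply_symm_apply]
  first_eq := by rw [← φ.first_eq, Equiv.symm_apply_apply]
  last_eq := by rw [← φ.last_eq, Equiv.symm_apply_apply]
  src_eq e := by rw [Equiv.eq_symm_apply, ← φ.src_eq, Equiv.apply_symm_apply]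
  tgt_eq e := by rw [Equiv.eq_symm_apply, ← φ.tgt_eq, Equiv.apply_symm_apply]

theorem path_surjective : Function.Surjective φ.path := fun σ =>
  ⟨φ.symm.path σ, FullPath.ext_edges (by simp [path, symm])⟩

theorem point_injective : Function.Injective φ.point := by
  refine Function.LeftInverse.injective (g := φ.symm.point) ?_
  rintro (v | ⟨e, t, ht⟩)
  · simp [point, symm]
  · rw [point, point_edgePoint]
    simp [symm, edgePoint_of_lt ht]

end Iso

/-! ### Adding an edge -/

section AddEdge

variable {G : TLG} {j k : G.V} {h : G.time j < G.time k}

theorem addEdgePoint_injective : Function.Injective (G.addEdgePoint j k h) := by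
  rintro (v | ⟨e, t, ht⟩) (v' | ⟨e', t', ht'⟩) hp
  · simpa [addEdgePoint] using hp
  · simp [addEdgePoint] at hp
  · simp [addEdgePoint] at hp
  · cases hp
    rfl

theorem addEdgePoint_ne_edgePoint (p : G.Point) {t : ℝ} (h₁ : G.time j < t) (h₂ : t < G.time k) :
    G.addEdgePoint j k h p ≠ (G.addEdge j k h).edgePoint none t := by
  rw [edgePoint_of_lt (G := G.addEdge j k h) (e := none) ⟨h₁, h₂⟩]
  cases p <;> exact nofun

theorem pathPoint_map_some (l : List G.E) (u : G.V) (t : ℝ) :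
    (G.addEdge j k h).pathPoint (l.map some) u t = G.addEdgePoint j k h (G.pathPoint l u t) := by
  have hedge : ∀ e, (G.addEdge j k h).edgePoint (some e) t =
      G.addEdgePoint j k h (G.edgePoint e t) := by
    intro e
    rcases le_or_gt t (G.time (G.src e)) with h₁ | h₁
    · rw [edgePoint_of_le h₁]
      exact edgePoint_of_le (G := G.addEdge j k h) (e := some e) h₁
    rcases le_or_gt (G.time (G.tgt e)) t with h₂ | h₂
    · rw [edgePoint_of_ge h₂]
      exact edgePoint_of_ge (G := G.addEdge j k h) (e := some e) h₂
    · rw [edgePoint_of_lt ⟨h₁, h₂⟩]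
      exact edgePoint_of_lt (G := G.addEdge j k h) (e := some e) ⟨h₁, h₂⟩
  induction l generalizing u with
  | nil => rfl
  | cons e l ih =>
    rw [List.map_cons, pathPoint, pathPoint, hedge, apply_ite (G.addEdgePoint j k h)]
    exact congrArg _ (ih _)

theorem addEdgePath_at (σ : G.FullPath) (t : Icc (0 : ℝ) 1) :
    (G.addEdgePath j k h σ).at t = G.addEdgePoint j k h (σ.at t) :=
  pathPoint_map_some σ.edges G.first t

theorem exists_map_some_of_none_notMem {l : List (Option G.E)} {u v : G.V}
    (hl : (G.addEdge j k h).IsTimePath l u v) (hn : none ∉ l) :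
    ∃ l', l = l'.map some ∧ G.IsTimePath l' u v := by
  induction l generalizing u with
  | nil => exact ⟨[], rfl, hl⟩
  | cons a l ih =>
    rcases a with _ | a
    · simp at hn
    · obtain ⟨l', rfl, h'⟩ := ih hl.2 (fun hh => hn (List.mem_cons_of_mem _ hh))
      exact ⟨a :: l', rfl, hl.1, h'⟩

theorem exists_addEdgePath_eq {σ' : (G.addEdge j k h).FullPath} (hn : none ∉ σ'.edges) :
    ∃ σ, G.addEdgePath j k h σ = σ' := by
  obtain ⟨l, h₁, h₂⟩ := exists_map_some_of_none_notMem σ'.isTimePath hn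
  exact ⟨⟨l, h₂⟩, FullPath.ext_edges h₁.symm⟩

/-- A full time-path through the added edge agrees with an old full time-path outside of this
edge. -/
theorem exists_bypass (hpath : ∃ l, G.IsTimePath l j k) {σ' : (G.addEdge j k h).FullPath}
    (hn : none ∈ σ'.edges) :
    ∃ σ : G.FullPath, σ.at (G.unitTime j) = .vertex j ∧ σ.at (G.unitTime k) = .vertex k ∧
      (∀ t, t ≤ G.unitTime j ∨ G.unitTime k ≤ t →
        σ'.at t = G.addEdgePoint j k h (σ.at t)) ∧
      ∀ t ∈ Icc (G.unitTime j) (G.unitTime k),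
        σ'.at t = (G.addEdge j k h).edgePoint none (t : ℝ) := by
  obtain ⟨l, hl⟩ := hpath
  obtain ⟨a', b', hab⟩ := List.append_of_mem hn
  have hpath' := σ'.isTimePath
  rw [hab] at hpath'
  obtain ⟨w, ha', hw, hb'⟩ := isTimePath_append.1 hpath'
  obtain rfl : j = w := hw
  -- A time-path uses the new edge only once: the edges before it end by the time of `j`, and those
  -- after it start no earlier than the time of `k`.
  obtain ⟨a, rfl, ha⟩ := exists_map_some_of_none_notMem ha'
    (fun hm => (ha'.time_mem hm).2.not_gt h)
  obtain ⟨b, rfl, hb⟩ := exists_map_some_of_none_notMem (u := k) hb'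
    (fun hm => (hb'.time_mem hm).1.not_gt h)
  have hat : ∀ t : Icc (0 : ℝ) 1, σ'.at t =
      (G.addEdge j k h).pathPoint (a.map some ++ none :: b.map some) G.first t := by
    intro t
    rw [FullPath.at, hab]
  have hlb := isTimePath_append.2 ⟨k, hl, hb⟩
  have hle : ∀ t : Icc (0 : ℝ) 1, t ≤ G.unitTime j →
      G.pathPoint (a ++ (l ++ b)) G.first t = G.pathPoint a G.first t := fun t ht =>
    pathPoint_append_of_le ha hlb ht
  have hge : ∀ t : Icc (0 : ℝ) 1, G.unitTime k ≤ t →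
      G.pathPoint (a ++ (l ++ b)) G.first t = G.pathPoint b k t := by
    intro t ht
    rw [pathPoint_append_of_ge _ ha (h.le.trans ht), pathPoint_append_of_ge _ hl ht]
  have hk : ∀ t : Icc (0 : ℝ) 1, G.unitTime k ≤ t →
      σ'.at t = G.addEdgePoint j k h (G.pathPoint b k t) := by
    intro t ht
    rw [hat, pathPoint_append_of_ge _ ha' (h.le.trans ht), ← pathPoint_map_some, pathPoint,
      if_neg (show ¬ (t : ℝ) < (G.addEdge j k h).time ((G.addEdge j k h).tgt none) from
        not_lt.2 ht)]
    rfl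
  -- The bypass replaces the new edge by the old time-path `l` from `j` to `k`.
  refine ⟨⟨a ++ (l ++ b), isTimePath_append.2 ⟨j, ha, hlb⟩⟩, ?_, ?_, ?_, ?_⟩
  · exact (hle _ le_rfl).trans (pathPoint_of_ge ha le_rfl)
  · exact (hge _ le_rfl).trans (pathPoint_of_le hb le_rfl)
  · rintro t (ht | ht)
    · rw [hat, pathPoint_append_of_le ha'
        (show (G.addEdge j k h).IsTimePath (none :: b.map some) j G.last from ⟨rfl, hb'⟩) ht, pathPoint_map_some]
      exact congrArg _ (hle t ht).symm
    · rw [hk t ht]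
      exact congrArg _ (hge t ht).symm
  · rintro t ⟨h₁, h₂⟩
    -- `pathPoint` leaves an edge at the time of its target, so at the time of `k` the point already
    -- comes from `b`.
    rcases h₂.eq_or_lt with rfl | h₂
    · refine (hk _ le_rfl).trans ((congrArg _ (pathPoint_of_le hb le_rfl)).trans ?_)
      exact (edgePoint_of_ge (G := G.addEdge j k h) (e := none) le_rfl).symm
    · rw [hat, pathPoint_append_of_ge _ ha' h₁, pathPoint,
        if_pos (show (t : ℝ) < (G.addEdge j k h).time ((G.addEdge j k h).tgt none) from h₂)]

end AddEdge

/-! ### The minimal graph -/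

theorem minimal_fullPath_eq (σ : minimal.FullPath) : σ = minimalPath := by
  apply FullPath.ext_edges
  obtain ⟨l, hl⟩ := σ
  match l, hl with
  | [], hl => simp [IsTimePath] at hl
  | [()], _ => rfl
  | () :: () :: l, hl => simp [IsTimePath] at hl

end TLG

namespace TLG

/-! ### The order -/

/-- Splice the two witnessing full time-paths at `v`. -/
theorem Point.Le.trans_vertex {G : TLG} {p q : G.Point} {v : G.V} (h₁ : p.Le (.vertex v))
    (h₂ : Point.Le (.vertex v) q) : p.Le q := by
  obtain ⟨σ₁, s, t, hst, hs, ht⟩ := Point.le_iff.1 h₁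
  obtain ⟨σ₂, s', t', hst', hs', ht'⟩ := Point.le_iff.1 h₂
  obtain ⟨σ, h, h'⟩ := FullPath.exists_splice ht hs'
  have et : t = G.unitTime v := Subtype.ext (by rw [← σ₁.time_at t, ht]; rfl)
  have es : s' = G.unitTime v := Subtype.ext (by rw [← σ₂.time_at s', hs']; rfl)
  subst et es
  refine Point.le_iff.2 ⟨σ, s, t', hst.trans hst', ?_, ?_⟩
  · rw [h s hst, hs]
  · rw [h' t' hst', ht']

/-! ### Laws along full time-paths -/

/-- Along every full time-path `σ`, the process `X` has the distribution `M σ`. -/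
def HasPathLaws {G : TLG} {Ω : Type*} [MeasurableSpace Ω] (P : Measure Ω)
    (M : G.FullPath → Measure PathSpace) (X : G.Point → Ω → ℝ) : Prop :=
  ∀ σ : G.FullPath,
    P.map (fun ω (t : Icc (0 : ℝ) 1) => X (σ.at t) ω) = (M σ).map Subtype.val

theorem measurable_pathSpace_apply (t : Icc (0 : ℝ) 1) :
    Measurable fun y : PathSpace => y.1 t :=
  (measurable_pi_apply t).comp measurable_subtype_coe

section PathLaws

variable {G : TLG} {Ω : Type*} [MeasurableSpace Ω] {P : Measure Ω}

theorem HasPathLaws.of_comp {H : TLG} {M : H.FullPath → Measure PathSpace} {X : H.Point → Ω → ℝ}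
    {φ : G.Point → H.Point} {F : G.FullPath → H.FullPath}
    (hF : ∀ σ t, (F σ).at t = φ (σ.at t)) (hsurj : Function.Surjective F)
    (h : HasPathLaws P (fun σ => M (F σ)) (fun p => X (φ p))) : HasPathLaws P M X := by
  intro σ'
  obtain ⟨σ, rfl⟩ := hsurj σ'
  simpa only [hF] using h σ

variable [IsProbabilityMeasure P]
  {M : G.FullPath → Measure PathSpace} {X : G.Point → Ω → ℝ}

/-- The Markov property depends on the law only, so it passes from path space to the product space
and from there back to `Ω`. -/
theorem HasPathLaws.condIndepGiven (h : HasPathLaws P M X) (hX : ∀ p, Measurable (X p))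
    (hM : IsMarkovFamily M) (σ : G.FullPath) (t : Icc (0 : ℝ) 1) :
    CondIndepGiven P (sigmaGen (fun s => X (σ.at s)) {t}) (sigmaGen (fun s => X (σ.at s)) (Iic t))
      (sigmaGen (fun s => X (σ.at s)) (Ici t)) := by
  have := hM.isProbabilityMeasure σ
  have hcoord : ∀ S : Set (Icc (0 : ℝ) 1),
      sigmaGen (fun (s : Icc (0 : ℝ) 1) (y : Icc (0 : ℝ) 1 → ℝ) => y s) S ≤
        MeasurableSpace.pi := fun S => sigmaGen_le fun i _ => measurable_pi_apply i
  have h1 := hM.isMarkovLaw σ t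
  have h2 : CondIndepGiven ((M σ).map Subtype.val)
      (sigmaGen (fun (s : Icc (0 : ℝ) 1) (y : Icc (0 : ℝ) 1 → ℝ) => y s) {t})
      (sigmaGen (fun (s : Icc (0 : ℝ) 1) (y : Icc (0 : ℝ) 1 → ℝ) => y s) (Iic t))
      (sigmaGen (fun (s : Icc (0 : ℝ) 1) (y : Icc (0 : ℝ) 1 → ℝ) => y s) (Ici t)) := by
    rw [condIndepGiven_map_iff measurable_subtype_coe (hcoord _) (hcoord _) (hcoord _)]
    simpa only [comap_sigmaGen] using h1
  rw [← h σ, condIndepGiven_map_iff (measurable_pi_iff.2 fun t => hX _) (hcoord _) (hcoord _)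
    (hcoord _)] at h2
  simpa only [comap_sigmaGen] using h2

theorem IsMarkovFamily.map_restrict_eq (hM : IsMarkovFamily M) {σ₁ σ₂ : G.FullPath}
    {S : Set (Icc (0 : ℝ) 1)} (h : ∀ t ∈ S, σ₁.at t = σ₂.at t) :
    (M σ₁).map (fun y (t : S) => y.1 t.1) = (M σ₂).map (fun y (t : S) => y.1 t.1) := by
  have hr : Measurable fun (z : {t : Icc (0 : ℝ) 1 // σ₁.at t = σ₂.at t} → ℝ) (t : S) =>
      z ⟨t.1, h t.1 t.2⟩ := measurable_pi_iff.2 fun t => measurable_pi_apply _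
  have hm : Measurable fun (y : PathSpace) (t : {t : Icc (0 : ℝ) 1 // σ₁.at t = σ₂.at t}) =>
      y.1 t.1 := measurable_pi_iff.2 fun t => measurable_pathSpace_apply t.1
  have := congrArg (Measure.map fun (z : {t : Icc (0 : ℝ) 1 // σ₁.at t = σ₂.at t} → ℝ) (t : S) =>
      z ⟨t.1, h t.1 t.2⟩) (hM.consistent σ₁ σ₂)
  rwa [Measure.map_map hr hm, Measure.map_map hr hm] at this

/-- The defining identity involves the path on [a, b] only. Hence the kernel chosen with one path
through an added edge serves all of them. -/
theorem IsBridgeKernel.of_map_restrict_eq {μ ν : Measure PathSpace} {a b : Icc (0 : ℝ) 1}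
    (hab : a ≤ b) {κ : Kernel (ℝ × ℝ) (Icc a b → ℝ)}
    (h : μ.map (fun y (t : Icc a b) => y.1 t.1) = ν.map (fun y (t : Icc a b) => y.1 t.1))
    (hμ : IsBridgeKernel μ a b κ) : IsBridgeKernel ν a b κ := by
  have hm : Measurable fun (y : PathSpace) (t : Icc a b) => y.1 t.1 :=
    measurable_pi_iff.2 fun t => measurable_pathSpace_apply t.1
  have he := measurable_evalPair (⟨a, left_mem_Icc.2 hab⟩ : Icc a b) ⟨b, right_mem_Icc.2 hab⟩
  have h1 := congrArg (Measure.map fun z : Icc a b → ℝ =>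
    (evalPair (⟨a, left_mem_Icc.2 hab⟩ : Icc a b) ⟨b, right_mem_Icc.2 hab⟩ z, z)) h
  have h2 := congrArg (Measure.map
    (evalPair (⟨a, left_mem_Icc.2 hab⟩ : Icc a b) ⟨b, right_mem_Icc.2 hab⟩)) h
  have hp : Measurable fun z : Icc a b → ℝ =>
      (evalPair (⟨a, left_mem_Icc.2 hab⟩ : Icc a b) ⟨b, right_mem_Icc.2 hab⟩ z, z) :=
    he.prodMk measurable_id
  rw [Measure.map_map hp hm, Measure.map_map hp hm] at h1
  rw [Measure.map_map he hm, Measure.map_map he hm] at h2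
  unfold IsBridgeKernel at hμ ⊢
  exact h1.symm.trans (hμ.trans (congrArg (· ⊗ₘ κ) h2))

theorem IsMarkovFamily.comp {H : TLG} {M : H.FullPath → Measure PathSpace}
    (hM : IsMarkovFamily M) {φ : G.Point → H.Point} {F : G.FullPath → H.FullPath}
    (hF : ∀ σ t, (F σ).at t = φ (σ.at t)) : IsMarkovFamily fun σ => M (F σ) where
  isProbabilityMeasure σ := hM.isProbabilityMeasure (F σ)
  isMarkovLaw σ := hM.isMarkovLaw (F σ)
  consistent σ₁ σ₂ := hM.map_restrict_eq (S := {t | σ₁.at t = σ₂.at t})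
    fun t ht => by rw [hF, hF, show σ₁.at t = σ₂.at t from ht]

/-- It suffices to consider points on full time-paths. -/
theorem isTimeMarkovian_of_forall_at (hX : ∀ p, Measurable (X p))
    (h : ∀ (σ : G.FullPath) (t : Icc (0 : ℝ) 1),
      CondIndepGiven P (sigmaGen X {σ.at t}) (sigmaGen X (past (σ.at t)))
        (sigmaGen X (future (σ.at t)))) : IsTimeMarkovian P X := by
  intro p
  by_cases hp : ∃ (σ : G.FullPath) (t : Icc (0 : ℝ) 1), σ.at t = p
  · obtain ⟨σ, t, rfl⟩ := hp
    exact h σ t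
  -- A point on no full time-path has an empty past, so there is no need to show that such points do
  -- not exist.
  · have : past p = ∅ := by
      rw [eq_empty_iff_forall_notMem]
      rintro q ⟨_, σ, _, ht⟩
      exact hp ⟨σ, ht⟩
    rw [this, sigmaGen_empty]
    exact condIndepGiven_bot_left (sigmaGen_le fun i _ => hX i)

/-- All full time-paths of `H` come from `G`, so pasts and futures in `H` are covered by images of
those in `G`; monotonicity does the rest. -/
theorem IsTimeMarkovian.of_comp {H : TLG} {X : H.Point → Ω → ℝ} (hX : ∀ p, Measurable (X p))
    {φ : G.Point → H.Point} (hφ : Function.Injective φ) {F : G.FullPath → H.FullPath}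
    (hF : ∀ σ t, (F σ).at t = φ (σ.at t)) (hsurj : Function.Surjective F)
    (h : IsTimeMarkovian P (fun p => X (φ p))) : IsTimeMarkovian P X := by
  refine isTimeMarkovian_of_forall_at hX fun σ' t => ?_
  obtain ⟨σ, rfl⟩ := hsurj σ'
  rw [hF]
  have key := h (σ.at t)
  simp only [← sigmaGen_image X φ, image_singleton] at key
  refine key.mono (sigmaGen_mono ?_) (sigmaGen_mono ?_)
  · intro q hq
    obtain ⟨σ₁, r, s, hrs, hr, hs⟩ := Point.le_iff.1 hq
    obtain ⟨σ₁, rfl⟩ := hsurj σ₁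
    rw [hF] at hr hs
    exact ⟨_, Point.le_iff.2 ⟨σ₁, r, s, hrs, rfl, hφ hs⟩, hr⟩
  · intro q hq
    obtain ⟨σ₁, r, s, hrs, hr, hs⟩ := Point.le_iff.1 hq
    obtain ⟨σ₁, rfl⟩ := hsurj σ₁
    rw [hF] at hr hs
    exact ⟨_, Point.le_iff.2 ⟨σ₁, r, s, hrs, hφ hr, rfl⟩, hs⟩

theorem isTimeMarkovian_minimal {M : minimal.FullPath → Measure PathSpace}
    {X : minimal.Point → Ω → ℝ} (hX : ∀ p, Measurable (X p)) (hM : IsMarkovFamily M)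
    (h : HasPathLaws P M X) : IsTimeMarkovian P X := by
  refine isTimeMarkovian_of_forall_at hX fun σ t => ?_
  have key := h.condIndepGiven hX hM σ t
  simp only [← sigmaGen_image X σ.at, image_singleton] at key
  refine key.mono (sigmaGen_mono ?_) (sigmaGen_mono ?_)
  · intro q hq
    obtain ⟨σ₁, r, s, hrs, hr, hs⟩ := Point.le_iff.1 hq
    obtain rfl : σ₁ = σ := (minimal_fullPath_eq _).trans (minimal_fullPath_eq _).symm
    obtain rfl := σ₁.at_injective hs
    exact ⟨r, hrs, hr⟩
  · intro q hq
    obtain ⟨σ₁, r, s, hrs, hr, hs⟩ := Point.le_iff.1 hq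
    obtain rfl : σ₁ = σ := (minimal_fullPath_eq _).trans (minimal_fullPath_eq _).symm
    obtain rfl := σ₁.at_injective hr
    exact ⟨s, hrs, hs⟩

end PathLaws

/-! ### Adding an edge: distribution along full time-paths -/

/-- For a Markov law, the path on `[a, b]` is conditionally independent of the path outside of
`(a, b)`, given the values at `a` and `b`. -/
theorem _root_.IsMarkovLaw.condIndepGiven_Icc {μ : Measure PathSpace} [IsProbabilityMeasure μ]
    (hμ : IsMarkovLaw μ) {a b : Icc (0 : ℝ) 1} (hab : a ≤ b) :
    CondIndepGiven μ (sigmaGen (fun (s : Icc (0 : ℝ) 1) (y : PathSpace) => y.1 s) {a, b})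
      (sigmaGen (fun (s : Icc (0 : ℝ) 1) (y : PathSpace) => y.1 s) (Icc a b))
      (sigmaGen (fun (s : Icc (0 : ℝ) 1) (y : PathSpace) => y.1 s) (Iic a ∪ Ici b)) := by
  have hle : ∀ S : Set (Icc (0 : ℝ) 1),
      sigmaGen (fun (s : Icc (0 : ℝ) 1) (y : PathSpace) => y.1 s) S ≤
        (inferInstance : MeasurableSpace PathSpace) := fun S =>
    sigmaGen_le fun i _ => measurable_pathSpace_apply i
  have ha := hμ a
  have hb := hμ b
  rw [← Icc_union_Ici_eq_Ici hab, sigmaGen_union] at ha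
  rw [← Iic_union_Icc_eq_Iic hab, sigmaGen_union] at hb
  rw [← singleton_union, sigmaGen_union, sigmaGen_union]
  exact ha.between hb (hle _) (hle _) (hle _) (sigmaGen_mono (by simp)) (sigmaGen_mono (by simp))

section AddEdge

variable {G : TLG} {j k : G.V} {h : G.time j < G.time k} {Ω : Type*} [MeasurableSpace Ω]
  {P : Measure Ω} [IsProbabilityMeasure P] {X : (G.addEdge j k h).Point → Ω → ℝ}

theorem hasPathLaws_addEdge (hpath : ∃ l, G.IsTimePath l j k)
    {M : (G.addEdge j k h).FullPath → Measure PathSpace} (hM : IsMarkovFamily M)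
    (hX : ∀ p, Measurable (X p))
    (hold : HasPathLaws P (fun σ => M (G.addEdgePath j k h σ))
      (fun p => X (G.addEdgePoint j k h p)))
    {σE : (G.addEdge j k h).FullPath} (hσE : none ∈ σE.edges)
    (κ : Kernel (ℝ × ℝ) (Icc (G.unitTime j) (G.unitTime k) → ℝ)) [IsMarkovKernel κ]
    (hκ : IsBridgeKernel (M σE) (G.unitTime j) (G.unitTime k) κ)
    (hnew : P.map (fun ω => ((fun p : G.Point => X (G.addEdgePoint j k h p) ω),
            (fun t : Icc (G.unitTime j) (G.unitTime k) =>
              X ((G.addEdge j k h).edgePoint none (t.1 : ℝ)) ω))) =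
          (P.map (fun ω (p : G.Point) => X (G.addEdgePoint j k h p) ω)) ⊗ₘ
            (κ.comap (evalPair (.vertex j) (.vertex k)) (measurable_evalPair _ _))) :
    HasPathLaws P M X := by
  classical
  intro σ'
  by_cases hn : none ∈ σ'.edges
  swap
  · obtain ⟨σ, rfl⟩ := exists_addEdgePath_eq hn
    simpa only [addEdgePath_at] using hold σ
  obtain ⟨σ, hj, hk, hout, hin⟩ := exists_bypass hpath hn
  obtain ⟨_, _, _, _, hinE⟩ := exists_bypass hpath hσE
  have hprob := hM.isProbabilityMeasure σ'
  have hab : G.unitTime j ≤ G.unitTime k := h.le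
  -- `O` overlaps with the time interval of the new edge in its two endpoints, so that the endpoint
  -- values are functions of the path on `O`.
  let O : Set (Icc (0 : ℝ) 1) := Iic (G.unitTime j) ∪ Ici (G.unitTime k)
  have haO : G.unitTime j ∈ O := Or.inl (mem_Iic.2 le_rfl)
  have hbO : G.unitTime k ∈ O := Or.inr (mem_Ici.2 le_rfl)
  let ev : (O → ℝ) → ℝ × ℝ := evalPair ⟨G.unitTime j, haO⟩ ⟨G.unitTime k, hbO⟩
  have hev : Measurable ev := measurable_evalPair _ _
  let r : (G.Point → ℝ) → (O → ℝ) := fun x t => x (σ.at t.1)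
  have hr : Measurable r := measurable_pi_iff.2 fun t => measurable_pi_apply _
  let f : Ω → G.Point → ℝ := fun ω p => X (G.addEdgePoint j k h p) ω
  have hf : Measurable f := measurable_pi_iff.2 fun p => hX _
  let g : Ω → Icc (G.unitTime j) (G.unitTime k) → ℝ := fun ω t => X ((G.addEdge j k h).edgePoint none (t.1 : ℝ)) ω
  have hg : Measurable g := measurable_pi_iff.2 fun t => hX _
  let f' : PathSpace → O → ℝ := fun y t => y.1 t.1
  have hf' : Measurable f' := measurable_pi_iff.2 fun t => measurable_pathSpace_apply t.1
  let g' : PathSpace → Icc (G.unitTime j) (G.unitTime k) → ℝ := fun y t => y.1 t.1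
  have hg' : Measurable g' := measurable_pi_iff.2 fun t => measurable_pathSpace_apply t.1
  have h1 : P.map (fun ω => (r (f ω), g ω)) = P.map (fun ω => r (f ω)) ⊗ₘ κ.comap ev hev := by
    refine map_prodMk_eq_compProd_of_comp hf hg hr hev κ (hnew.trans ?_)
    congr 1
    ext x : 1
    simp only [Kernel.comap_apply]
    congr 1
    simp only [evalPair, ev, r, hj, hk]
  have h2 : P.map (fun ω => r (f ω)) = (M σ').map f' := by
    have e1 := congrArg (Measure.map fun (z : Icc (0 : ℝ) 1 → ℝ) (t : O) => z t.1) (hold σ)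
    have hz : Measurable fun (z : Icc (0 : ℝ) 1 → ℝ) (t : O) => z t.1 :=
      measurable_pi_iff.2 fun t => measurable_pi_apply _
    rw [Measure.map_map hz (measurable_pi_iff.2 fun t => hX _),
      Measure.map_map hz measurable_subtype_coe] at e1
    refine e1.trans (hM.map_restrict_eq (S := O) fun t ht => ?_)
    rw [addEdgePath_at, hout t ht]
  -- The prescribed law disintegrates with the same kernel: `κ` transfers from `σE` to `σ'`, and the
  -- Markov property extends the condition from the endpoint values to the whole path on `O`.
  have h3 : (M σ').map (fun y => (f' y, g' y)) = (M σ').map f' ⊗ₘ κ.comap ev hev := by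
    have hbr : IsBridgeKernel (M σ') (G.unitTime j) (G.unitTime k) κ :=
      IsBridgeKernel.of_map_restrict_eq hab (hM.map_restrict_eq (S := Icc (G.unitTime j) (G.unitTime k)) fun t ht => by
        rw [hinE t ht, hin t ht]) hκ
    refine map_prodMk_eq_compProd_of_condIndepGiven hf' hg' hev κ hbr ?_
    have e := (hM.isMarkovLaw σ').condIndepGiven_Icc hab
    rw [← comap_evalPair_eq_sigmaGen, ← comap_pi_subtype_eq_sigmaGen,
      ← comap_pi_subtype_eq_sigmaGen] at e
    exact e
  -- Reassembles a path from its two pieces; the default 0 is never reached, by `hO` below.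
  let comb : (O → ℝ) × (Icc (G.unitTime j) (G.unitTime k) → ℝ) → Icc (0 : ℝ) 1 → ℝ := fun z t =>
    if ht : t ∈ Icc (G.unitTime j) (G.unitTime k) then z.2 ⟨t, ht⟩ else if ht' : t ∈ O then z.1 ⟨t, ht'⟩ else 0
  have hcomb : Measurable comb := by
    refine measurable_pi_iff.2 fun t => ?_
    by_cases ht : t ∈ Icc (G.unitTime j) (G.unitTime k)
    · simp only [comb, ht, dif_pos]
      exact (measurable_pi_apply _).comp measurable_snd
    by_cases ht' : t ∈ O
    · simp only [comb, ht, ht', dif_pos, dif_neg, not_false_eq_true]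
      exact (measurable_pi_apply _).comp measurable_fst
    · simp only [comb, ht, ht', dif_neg, not_false_eq_true]
      exact measurable_const
  have hO : ∀ t, t ∉ Icc (G.unitTime j) (G.unitTime k) → t ∈ O := by
    intro t ht
    rcases le_total t (G.unitTime j) with h' | h'
    · exact Or.inl h'
    · exact Or.inr (not_lt.1 fun h'' => ht ⟨h', h''.le⟩)
  have h4 := congrArg (Measure.map comb) (h1.trans ((congrArg (· ⊗ₘ κ.comap ev hev) h2).trans
    h3.symm))
  have hrfg : Measurable fun ω => (r (f ω), g ω) := (hr.comp hf).prodMk hg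
  rw [Measure.map_map hcomb hrfg, Measure.map_map hcomb (hf'.prodMk hg')] at h4
  convert h4 using 2
  · ext ω t
    by_cases ht : t ∈ Icc (G.unitTime j) (G.unitTime k)
    · simp only [Function.comp_apply, comb, ht, dif_pos, g]
      rw [hin t ht]
    · have ht' := hO t ht
      simp only [Function.comp_apply, comb, ht, ht', dif_pos, dif_neg, not_false_eq_true, r, f]
      rw [hout t ht']
  · ext y t
    by_cases ht : t ∈ Icc (G.unitTime j) (G.unitTime k)
    · simp only [Function.comp_apply, comb, ht, dif_pos, g']
    · have ht' := hO t ht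
      simp only [Function.comp_apply, comb, ht, ht', dif_pos, dif_neg, not_false_eq_true, f']

/-! ### Adding an edge: the time-Markov property -/

/-- A path avoiding the new edge is old. On a path through it, the cases record which of the two
times fall within the edge; points outside move to the bypass, and points within lie on the fixed
path `σE` as well. -/
theorem le_addEdge_cases (hpath : ∃ l, G.IsTimePath l j k) {p q : (G.addEdge j k h).Point}
    (hpq : p.Le q) {σE : (G.addEdge j k h).FullPath} (hσE : none ∈ σE.edges) :
    (∃ p' q' : G.Point, G.addEdgePoint j k h p' = p ∧ G.addEdgePoint j k h q' = q ∧ p'.Le q') ∨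
    (∃ p' : G.Point, G.addEdgePoint j k h p' = p ∧ p'.Le (.vertex j) ∧
      ∃ t ∈ Icc (G.unitTime j) (G.unitTime k), σE.at t = q) ∨
    (∃ q' : G.Point, G.addEdgePoint j k h q' = q ∧ Point.Le (.vertex k) q' ∧
      ∃ t ∈ Icc (G.unitTime j) (G.unitTime k), σE.at t = p) ∨
    ∃ s ∈ Icc (G.unitTime j) (G.unitTime k), ∃ t ∈ Icc (G.unitTime j) (G.unitTime k),
      s ≤ t ∧ σE.at s = p ∧ σE.at t = q := by
  obtain ⟨σ', s, t, hst, rfl, rfl⟩ := Point.le_iff.1 hpq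
  by_cases hn : none ∈ σ'.edges
  swap
  · obtain ⟨σ, rfl⟩ := exists_addEdgePath_eq hn
    exact Or.inl ⟨σ.at s, σ.at t, (addEdgePath_at _ _).symm, (addEdgePath_at _ _).symm,
      Point.le_iff.2 ⟨σ, s, t, hst, rfl, rfl⟩⟩
  obtain ⟨σ, hj, hk, hout, hin⟩ := exists_bypass hpath hn
  obtain ⟨_, _, _, _, hinE⟩ := exists_bypass hpath hσE
  have hE : ∀ t ∈ Icc (G.unitTime j) (G.unitTime k), σE.at t = σ'.at t := fun t ht => by
    rw [hinE t ht, hin t ht]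
  by_cases hs : s ∈ Icc (G.unitTime j) (G.unitTime k) <;>
    by_cases ht : t ∈ Icc (G.unitTime j) (G.unitTime k)
  · exact Or.inr (Or.inr (Or.inr ⟨s, hs, t, ht, hst, hE s hs, hE t ht⟩))
  · have ht' : G.unitTime k ≤ t := not_lt.1 fun h' => ht ⟨hs.1.trans hst, h'.le⟩
    exact Or.inr (Or.inr (Or.inl ⟨σ.at t, (hout t (Or.inr ht')).symm,
      Point.le_iff.2 ⟨σ, _, t, ht', hk, rfl⟩, s, hs, hE s hs⟩))
  · have hs' : s ≤ G.unitTime j := not_lt.1 fun h' => hs ⟨h'.le, hst.trans ht.2⟩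
    exact Or.inr (Or.inl ⟨σ.at s, (hout s (Or.inl hs')).symm,
      Point.le_iff.2 ⟨σ, s, _, hs', rfl, hj⟩, t, ht, hE t ht⟩)
  · have hO : ∀ t, t ∉ Icc (G.unitTime j) (G.unitTime k) →
        t ≤ G.unitTime j ∨ G.unitTime k ≤ t := by
      intro t ht
      rcases le_total t (G.unitTime j) with h' | h'
      · exact Or.inl h'
      · exact Or.inr (not_lt.1 fun h'' => ht ⟨h', h''.le⟩)
    exact Or.inl ⟨σ.at s, σ.at t, (hout s (hO s hs)).symm, (hout t (hO t ht)).symm,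
      Point.le_iff.2 ⟨σ, s, t, hst, rfl, rfl⟩⟩

/-- The new edge meets the old graph in its endpoints only; this settles the degenerate cases in the
descriptions of past and future. -/
theorem eq_vertex_of_at_addedEdge_eq (hpath : ∃ l, G.IsTimePath l j k)
    {σE : (G.addEdge j k h).FullPath} (hσE : none ∈ σE.edges) (p : G.Point) {t : Icc (0 : ℝ) 1}
    (ht : t ∈ Icc (G.unitTime j) (G.unitTime k)) (he : σE.at t = G.addEdgePoint j k h p) :
    (t = G.unitTime j ∧ p = .vertex j) ∨ (t = G.unitTime k ∧ p = .vertex k) := by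
  obtain ⟨σ, hj, hk, hout, hin⟩ := exists_bypass hpath hσE
  by_cases hO : t ≤ G.unitTime j ∨ G.unitTime k ≤ t
  · rw [hout t hO] at he
    have := addEdgePoint_injective he
    rcases hO with hO | hO
    · obtain rfl := le_antisymm hO ht.1
      exact Or.inl ⟨rfl, this.symm.trans hj⟩
    · obtain rfl := le_antisymm ht.2 hO
      exact Or.inr ⟨rfl, this.symm.trans hk⟩
  · push Not at hO
    rw [hin t ht] at he
    exact absurd he.symm (addEdgePoint_ne_edgePoint p hO.1 hO.2)

/-- A time-path that reaches an old point after going inside the new edge has to leave this edge at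
`k`. -/
theorem past_addEdgePoint_subset (hpath : ∃ l, G.IsTimePath l j k)
    {σE : (G.addEdge j k h).FullPath} (hσE : none ∈ σE.edges) (p : G.Point) :
    past (G.addEdgePoint j k h p) ⊆ G.addEdgePoint j k h '' past p ∪
      {q | Point.Le (.vertex k) p ∧ q ∈ σE.at '' Icc (G.unitTime j) (G.unitTime k)} := by
  obtain ⟨σ, hj, hk, hout, hin⟩ := exists_bypass hpath hσE
  have hab : G.unitTime j ≤ G.unitTime k := h.le
  have hpt := fun t => eq_vertex_of_at_addedEdge_eq (t := t) hpath hσE p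
  have hjk : Point.Le (.vertex j : G.Point) (.vertex k) :=
    Point.le_iff.2 ⟨σ, _, _, hab, hj, hk⟩
  have hjj : Point.Le (.vertex j : G.Point) (.vertex j) :=
    Point.le_iff.2 ⟨σ, _, _, le_rfl, hj, hj⟩
  have hkk : Point.Le (.vertex k : G.Point) (.vertex k) :=
    Point.le_iff.2 ⟨σ, _, _, le_rfl, hk, hk⟩
  intro q hq
  rcases le_addEdge_cases hpath hq hσE with ⟨p', q', rfl, hq', hle⟩ | ⟨p', rfl, hle, t, ht, he⟩ |
    ⟨q', hq', hle, t, ht, he⟩ | ⟨s, hs, t, ht, hst, rfl, he⟩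
  · obtain rfl := addEdgePoint_injective hq'
    exact Or.inl ⟨p', hle, rfl⟩
  · rcases hpt t ht he with ⟨-, rfl⟩ | ⟨-, rfl⟩
    · exact Or.inl ⟨p', hle, rfl⟩
    · exact Or.inl ⟨p', hle.trans_vertex hjk, rfl⟩
  · obtain rfl := addEdgePoint_injective hq'
    exact Or.inr ⟨hle, t, ht, he⟩
  · rcases hpt t ht he with ⟨rfl, rfl⟩ | ⟨rfl, rfl⟩
    · obtain rfl := le_antisymm hst hs.1
      exact Or.inl ⟨.vertex j, hjj, he.symm⟩
    · exact Or.inr ⟨hkk, s, hs, rfl⟩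

theorem future_addEdgePoint_subset (hpath : ∃ l, G.IsTimePath l j k)
    {σE : (G.addEdge j k h).FullPath} (hσE : none ∈ σE.edges) (p : G.Point) :
    future (G.addEdgePoint j k h p) ⊆ G.addEdgePoint j k h '' future p ∪
      {q | Point.Le p (.vertex j) ∧ q ∈ σE.at '' Icc (G.unitTime j) (G.unitTime k)} := by
  obtain ⟨σ, hj, hk, hout, hin⟩ := exists_bypass hpath hσE
  have hab : G.unitTime j ≤ G.unitTime k := h.le
  have hpt := fun t => eq_vertex_of_at_addedEdge_eq (t := t) hpath hσE p
  have hjk : Point.Le (.vertex j : G.Point) (.vertex k) :=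
    Point.le_iff.2 ⟨σ, _, _, hab, hj, hk⟩
  have hjj : Point.Le (.vertex j : G.Point) (.vertex j) :=
    Point.le_iff.2 ⟨σ, _, _, le_rfl, hj, hj⟩
  have hkk : Point.Le (.vertex k : G.Point) (.vertex k) :=
    Point.le_iff.2 ⟨σ, _, _, le_rfl, hk, hk⟩
  intro q hq
  rcases le_addEdge_cases hpath hq hσE with ⟨p', q', hp', rfl, hle⟩ | ⟨p', hp', hle, t, ht, he⟩ |
    ⟨q', rfl, hle, t, ht, he⟩ | ⟨s, hs, t, ht, hst, he, rfl⟩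
  · obtain rfl := addEdgePoint_injective hp'
    exact Or.inl ⟨q', hle, rfl⟩
  · obtain rfl := addEdgePoint_injective hp'
    exact Or.inr ⟨hle, t, ht, he⟩
  · rcases hpt t ht he with ⟨-, rfl⟩ | ⟨-, rfl⟩
    · exact Or.inl ⟨q', hjk.trans_vertex hle, rfl⟩
    · exact Or.inl ⟨q', hle, rfl⟩
  · rcases hpt s hs he with ⟨rfl, rfl⟩ | ⟨rfl, rfl⟩
    · exact Or.inr ⟨hjj, t, ht, rfl⟩
    · obtain rfl := le_antisymm ht.2 hst
      exact Or.inl ⟨.vertex k, hkk, he.symm⟩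

/-- An interior point of the new edge is not an old point, and it can be reached from the old graph
only through `j`. -/
theorem past_at_addedEdge_subset (hpath : ∃ l, G.IsTimePath l j k)
    {σE : (G.addEdge j k h).FullPath} (hσE : none ∈ σE.edges) {t : Icc (0 : ℝ) 1}
    (hjt : G.unitTime j < t) (htk : t < G.unitTime k) :
    past (σE.at t) ⊆ G.addEdgePoint j k h '' past (.vertex j) ∪
      σE.at '' Icc (G.unitTime j) t := by
  obtain ⟨_, _, _, _, hin⟩ := exists_bypass hpath hσE
  have hne : ∀ p, G.addEdgePoint j k h p ≠ σE.at t := fun p => by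
    rw [hin t ⟨hjt.le, htk.le⟩]
    exact addEdgePoint_ne_edgePoint p hjt htk
  intro q hq
  rcases le_addEdge_cases hpath hq hσE with ⟨p', q', rfl, hq', hle⟩ | ⟨p', rfl, hle, s, hs, he⟩ |
    ⟨q', hq', hle, s, hs, he⟩ | ⟨s, hs, s', hs', hst, rfl, he⟩
  · exact absurd hq' (hne _)
  · exact Or.inl ⟨p', hle, rfl⟩
  · exact absurd hq' (hne _)
  · obtain rfl := σE.at_injective he
    exact Or.inr ⟨s, ⟨hs.1, hst⟩, rfl⟩

theorem future_at_addedEdge_subset (hpath : ∃ l, G.IsTimePath l j k)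
    {σE : (G.addEdge j k h).FullPath} (hσE : none ∈ σE.edges) {t : Icc (0 : ℝ) 1}
    (hjt : G.unitTime j < t) (htk : t < G.unitTime k) :
    future (σE.at t) ⊆ G.addEdgePoint j k h '' future (.vertex k) ∪
      σE.at '' Icc t (G.unitTime k) := by
  obtain ⟨_, _, _, _, hin⟩ := exists_bypass hpath hσE
  have hne : ∀ p, G.addEdgePoint j k h p ≠ σE.at t := fun p => by
    rw [hin t ⟨hjt.le, htk.le⟩]
    exact addEdgePoint_ne_edgePoint p hjt htk
  intro q hq
  rcases le_addEdge_cases hpath hq hσE with ⟨p', q', hp', rfl, hle⟩ | ⟨p', hp', hle, s, hs, he⟩ |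
    ⟨q', rfl, hle, s, hs, he⟩ | ⟨s, hs, s', hs', hst, he, rfl⟩
  · exact absurd hp' (hne _)
  · exact absurd hp' (hne _)
  · exact Or.inl ⟨q', hle, rfl⟩
  · obtain rfl := σE.at_injective he
    exact Or.inr ⟨s', ⟨hst, hs'.2⟩, rfl⟩

/-- The time-Markov property is preserved if an edge is added. -/
theorem isTimeMarkovian_addEdge (hpath : ∃ l, G.IsTimePath l j k) (hX : ∀ p, Measurable (X p))
    (hold : IsTimeMarkovian P (fun p => X (G.addEdgePoint j k h p)))
    {σE : (G.addEdge j k h).FullPath} (hσE : none ∈ σE.edges)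
    (hE : ∀ t, CondIndepGiven P (sigmaGen (fun s => X (σE.at s)) {t})
      (sigmaGen (fun s => X (σE.at s)) (Iic t)) (sigmaGen (fun s => X (σE.at s)) (Ici t)))
    (hnew : CondIndepGiven P
      (sigmaGen (fun p => X (G.addEdgePoint j k h p)) {.vertex j, .vertex k})
      (sigmaGen (fun s => X (σE.at s)) (Icc (G.unitTime j) (G.unitTime k)))
      (sigmaGen (fun p => X (G.addEdgePoint j k h p)) univ)) :
    IsTimeMarkovian P X := by
  obtain ⟨σ, hj, hk, hout, hin⟩ := exists_bypass hpath hσE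
  have hab : G.unitTime j ≤ G.unitTime k := h.le
  have hjk : Point.Le (.vertex j : G.Point) (.vertex k) :=
    Point.le_iff.2 ⟨σ, _, _, hab, hj, hk⟩
  have hjj : Point.Le (.vertex j : G.Point) (.vertex j) :=
    Point.le_iff.2 ⟨σ, _, _, le_rfl, hj, hj⟩
  have hkk : Point.Le (.vertex k : G.Point) (.vertex k) :=
    Point.le_iff.2 ⟨σ, _, _, le_rfl, hk, hk⟩
  have hle : ∀ S, sigmaGen (fun p => X (G.addEdgePoint j k h p)) S ≤ ‹MeasurableSpace Ω› :=
    fun S => sigmaGen_le fun p _ => hX _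
  have hleE : ∀ S, sigmaGen (fun s => X (σE.at s)) S ≤ ‹MeasurableSpace Ω› :=
    fun S => sigmaGen_le fun p _ => hX _
  have hsub : ∀ S T, sigmaGen X (G.addEdgePoint j k h '' S ∪ σE.at '' T) =
      sigmaGen (fun p => X (G.addEdgePoint j k h p)) S ⊔ sigmaGen (fun s => X (σE.at s)) T :=
    fun S T => by rw [sigmaGen_union, sigmaGen_image, sigmaGen_image]
  have hpoint : ∀ p : G.Point, p.Le p → CondIndepGiven P
      (sigmaGen X {G.addEdgePoint j k h p}) (sigmaGen X (past (G.addEdgePoint j k h p)))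
      (sigmaGen X (future (G.addEdgePoint j k h p))) := by
    intro p hpp
    have hP := past_addEdgePoint_subset hpath hσE p
    have hF := future_addEdgePoint_subset hpath hσE p
    have key := hold p
    rw [← image_singleton, sigmaGen_image]
    by_cases hkp : Point.Le (.vertex k) p
    -- Otherwise the time of `k` would be at most that of `j`. So the future gains nothing, and the
    -- past, which contains `j` and `k`, absorbs the new edge.
    · have hpj : ¬ Point.Le p (.vertex j) := fun hpj => (hkp.1.trans hpj.1).not_gt h
      simp only [hkp, hpj, true_and, false_and, ofPred_mem_eq, ofPred_false, union_empty] at hP hF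
      refine (key.sup_left hnew (hle _) (hleE _) (sigmaGen_mono (subset_univ _))
        (sigmaGen_mono (subset_univ _)) (sigmaGen_mono ?_) (sigmaGen_mono ?_)).mono ?_ ?_
      · exact insert_subset (hjk.trans_vertex hkp) (singleton_subset_iff.2 hkp)
      · exact singleton_subset_iff.2 hpp
      · rw [← hsub]
        exact sigmaGen_mono hP
      · rw [← sigmaGen_image X (G.addEdgePoint j k h)]
        exact sigmaGen_mono hF
    by_cases hpj : Point.Le p (.vertex j)
    · simp only [hkp, hpj, true_and, false_and, ofPred_mem_eq, ofPred_false, union_empty] at hP hF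
      refine (key.symm.sup_left hnew (hle _) (hleE _) (sigmaGen_mono (subset_univ _))
        (sigmaGen_mono (subset_univ _)) (sigmaGen_mono ?_) (sigmaGen_mono ?_)).symm.mono ?_ ?_
      · exact insert_subset hpj (singleton_subset_iff.2 (hpj.trans_vertex hjk))
      · exact singleton_subset_iff.2 hpp
      · rw [← sigmaGen_image X (G.addEdgePoint j k h)]
        exact sigmaGen_mono hP
      · rw [← hsub]
        exact sigmaGen_mono hF
    · simp only [hkp, hpj, false_and, ofPred_false, union_empty] at hP hF
      refine key.mono ?_ ?_
      · rw [← sigmaGen_image X (G.addEdgePoint j k h)]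
        exact sigmaGen_mono hP
      · rw [← sigmaGen_image X (G.addEdgePoint j k h)]
        exact sigmaGen_mono hF
  refine isTimeMarkovian_of_forall_at hX fun σ' t => ?_
  -- If no old full time-path is at this point at time `t`, the point is strictly inside the new
  -- edge.
  by_cases hO : ∃ ρ : G.FullPath, σ'.at t = G.addEdgePoint j k h (ρ.at t)
  · obtain ⟨ρ, hρ⟩ := hO
    rw [hρ]
    exact hpoint _ (Point.le_iff.2 ⟨ρ, t, t, le_rfl, rfl, rfl⟩)
  have hn : none ∈ σ'.edges := by
    by_contra hn
    obtain ⟨ρ, rfl⟩ := exists_addEdgePath_eq hn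
    exact hO ⟨ρ, addEdgePath_at _ _⟩
  obtain ⟨ρ, _, _, hout', hin'⟩ := exists_bypass hpath hn
  have hjt : G.unitTime j < t := not_le.1 fun h' => hO ⟨ρ, hout' t (Or.inl h')⟩
  have htk : t < G.unitTime k := not_le.1 fun h' => hO ⟨ρ, hout' t (Or.inr h')⟩
  have ht : t ∈ Icc (G.unitTime j) (G.unitTime k) := ⟨hjt.le, htk.le⟩
  rw [hin' t ht, ← hin t ht, ← image_singleton, sigmaGen_image]
  have hJ : sigmaGen (fun p => X (G.addEdgePoint j k h p)) {.vertex j} =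
      sigmaGen (fun s => X (σE.at s)) {G.unitTime j} := by
    rw [← sigmaGen_image X (G.addEdgePoint j k h), ← sigmaGen_image X σE.at, image_singleton, image_singleton,
      hout _ (Or.inl le_rfl), hj]
  have hK : sigmaGen (fun p => X (G.addEdgePoint j k h p)) {.vertex k} =
      sigmaGen (fun s => X (σE.at s)) {G.unitTime k} := by
    rw [← sigmaGen_image X (G.addEdgePoint j k h), ← sigmaGen_image X σE.at, image_singleton, image_singleton,
      hout _ (Or.inr le_rfl), hk]
  have hY : CondIndepGiven P
      (sigmaGen (fun p => X (G.addEdgePoint j k h p)) {.vertex j} ⊔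
        sigmaGen (fun p => X (G.addEdgePoint j k h p)) {.vertex k})
      (sigmaGen (fun s => X (σE.at s)) (Icc (G.unitTime j) t) ⊔
        sigmaGen (fun s => X (σE.at s)) (Icc t (G.unitTime k)))
      (sigmaGen (fun p => X (G.addEdgePoint j k h p)) (past (.vertex j)) ⊔
        sigmaGen (fun p => X (G.addEdgePoint j k h p)) (future (.vertex k))) := by
    rw [← sigmaGen_union, ← sigmaGen_union, ← sigmaGen_union, Icc_union_Icc_eq_Icc hjt.le htk.le]
    exact hnew.mono le_rfl (sigmaGen_mono (subset_univ _))
  -- Here A is the past of `j`, B the future of `k`, and `Y₁`, `Y₂` are the pieces of the new edge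
  -- before and after `t`. The old Markov property at `j` and at `k` separates A from B because j ≼
  -- k.
  refine (CondIndepGiven.bridge
    ((hE t).mono (sigmaGen_mono Icc_subset_Iic_self) (sigmaGen_mono Icc_subset_Ici_self)) hY
    ((hold (.vertex j)).mono le_rfl (sigmaGen_mono fun q hq => hjk.trans_vertex hq))
    ((hold (.vertex k)).mono (sigmaGen_mono fun q hq => Point.Le.trans_vertex hq hjk) le_rfl)
    (hleE _) (hleE _) (hle _) (hle _) (sigmaGen_mono (singleton_subset_iff.2 hjj))
    (sigmaGen_mono (singleton_subset_iff.2 hkk)) ?_ ?_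
    (sigmaGen_mono (singleton_subset_iff.2 ⟨hjt.le, le_rfl⟩))
    (sigmaGen_mono (singleton_subset_iff.2 ⟨le_rfl, htk.le⟩))).mono ?_ ?_
  · rw [hJ]
    exact sigmaGen_mono (singleton_subset_iff.2 ⟨le_rfl, hjt.le⟩)
  · rw [hK]
    exact sigmaGen_mono (singleton_subset_iff.2 ⟨htk.le, le_rfl⟩)
  · rw [← hsub]
    exact sigmaGen_mono (past_at_addedEdge_subset hpath hσE hjt htk)
  · rw [← hsub]
    exact sigmaGen_mono (future_at_addedEdge_subset hpath hσE hjt htk)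

end AddEdge

/-! ### Natural processes -/

/-- A natural `M`-process has the distributions `M` along full time-paths and is time-Markovian. -/
theorem Tower.IsNatural.hasPathLaws_and_isTimeMarkovian {Ω : Type*} [MeasurableSpace Ω]
    {P : Measure Ω} [IsProbabilityMeasure P] {G : TLG} {T : Tower G}
    {M : G.FullPath → Measure PathSpace} {X : G.Point → Ω → ℝ} (hN : T.IsNatural P M X)
    (hM : IsMarkovFamily M) (hX : ∀ p, Measurable (X p)) :
    HasPathLaws P M X ∧ IsTimeMarkovian P X := by
  induction T with
  | minimal =>
    have hlaw : HasPathLaws P M X := fun σ => by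
      rw [minimal_fullPath_eq σ]
      exact hN
    exact ⟨hlaw, isTimeMarkovian_minimal hX hM hlaw⟩
  | addVertex T e τ h ih =>
    obtain ⟨h₁, h₂⟩ := ih hN (hM.comp addVertexPath_at) fun p => hX _
    exact ⟨h₁.of_comp addVertexPath_at addVertexPath_surjective,
      h₂.of_comp hX addVertexPoint_injective addVertexPath_at addVertexPath_surjective⟩
  | addEdge T j k h hpath ih =>
    obtain ⟨hN, σE, hσE, κ, hκ, hbridge, hnew⟩ := hN
    obtain ⟨h₁, h₂⟩ := ih hN (hM.comp addEdgePath_at) fun p => hX _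
    -- The laws in the enlarged graph come first: they give the Markov property along `σE`, hence
    -- inside the new edge.
    have hlaw := hasPathLaws_addEdge hpath hM hX h₁ hσE κ hbridge hnew
    refine ⟨hlaw, isTimeMarkovian_addEdge hpath hX h₂ hσE (hlaw.condIndepGiven hX hM σE) ?_⟩
    obtain ⟨_, _, _, _, hin⟩ := exists_bypass hpath hσE
    have e := condIndepGiven_of_map_prodMk_eq_compProd (measurable_pi_iff.2 fun p => hX _)
      (measurable_pi_iff.2 fun t => hX _) (measurable_evalPair _ _) κ hnew
    have hE : (fun ω (t : Icc (TLG.unitTime _ j) (TLG.unitTime _ k)) => X (σE.at t.1) ω) =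
        fun ω t => X ((TLG.addEdge _ j k h).edgePoint none (t.1 : ℝ)) ω := by
      ext ω t
      rw [hin t.1 t.2]
    rw [← comap_pi_eq_sigmaGen, ← comap_evalPair_eq_sigmaGen, ← comap_pi_subtype_eq_sigmaGen, hE]
    exact e
  | relabel T φ ih =>
    obtain ⟨h₁, h₂⟩ := ih hN (hM.comp φ.path_at) fun p => hX _
    exact ⟨h₁.of_comp φ.path_at φ.path_surjective,
      h₂.of_comp hX φ.point_injective φ.path_at φ.path_surjective⟩

end TLG

theorem mainTheorem4 (G : TLG) (T : TLG.Tower G)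
    (M : G.FullPath → Measure PathSpace) (hM : TLG.IsMarkovFamily M)
    {Ω : Type*} [MeasurableSpace Ω] (P : Measure Ω) [IsProbabilityMeasure P]
    (X : G.Point → Ω → ℝ) (hX : ∀ p, Measurable (X p))
    (hN : T.IsNatural P M X) :
    TLG.IsTimeMarkovian P X :=
  (hN.hasPathLaws_and_isTimeMarkovian hM hX).2
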